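/- Let $q=2^r$ with $r\ge 1$, and let $\mathbb F_q$ be the field with $q$ elements. For $x\in\mathbb F_q$ put $tr(x)=x+x^2+\cdots+x^{2^{r-1}}\in\{0,1\}$, $\lambda(x)=(-1)^{tr(x)}$, and for $a\in\mathbb F_q^*$ let $K(\lambda;a)=\sum_{\alpha\in\mathbb F_q^*}\lambda(\alpha+a\alpha^{-1})$. Let $Sp(2n,q)=\{w\in GL(2n,q) : {}^twJw=J\}$ with $J=\begin{bmatrix}0&1_n\\1_n&0\end{bmatrix}$, let $$P=\left\{\begin{bmatrix}A&0\\0&{}^tA^{-1}\end{bmatrix}\begin{bmatrix}1_n&B\\0&1_n\end{bmatrix} : A\in GL(n,q),\ {}^tB=B\right\}\subset Sp(2n,q),$$ and for $0\le s\le n$ let $$\sigma_s=\begin{bmatrix}0&0&1_s&0\\0&1_{n-s}&0&0\\1_s&0&0&0\\0&0&0&1_{n-s}\end{bmatrix}\in Sp(2n,q).$$ Put $DC^-(n,q)=P\sigma_{n-1}P$ for $n$ odd, and $DC^+(n,q)=P\sigma_{n-2}P$ for $n\ge 2$ even. For $\beta\in\mathbb F_q$ let $N_{DC^{\mp}(n,q)}(\beta)$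 be the number of $w\in DC^{\mp}(n,q)$ with matrix trace $\operatorname{Tr}w=\beta$. With $\left[{n\atop s}\right]_q=\prod_{j=0}^{s-1}\frac{q^{n-j}-1}{q^{s-j}-1}$, let $$A^-(n,q)=q^{\frac14(5n^2-1)}\left[{n\atop 1}\right]_q\prod_{j=1}^{(n-1)/2}(q^{2j-1}-1),\qquad B^-(n,q)=q^{\frac14(n-1)^2}(q^n-1)\prod_{j=1}^{(n-1)/2}(q^{2j}-1)$$ for $n$ odd, and $$A^+(n,q)=q^{\frac14(5n^2-2n)}\left[{n\atop 2}\right]_q\prod_{j=1}^{(n-2)/2}(q^{2j-1}-1),\qquad B^+(n,q)=q^{\frac14(n-2)^2}(q^n-1)(q^{n-1}-1)\prod_{j=1}^{(n-2)/2}(q^{2j}-1)$$ for $n\ge 2$ even. (a) For every odd $n\ge 1$ and every $\beta\in\mathbb F_q$, $$N_{DC^-(n,q)}(\beta)=q^{-1}A^-(n,q)B^-(n,q)+q^{-1}A^-(n,q)\times\begin{cases}1,&\beta=0,\\ q+1,&\beta\ne0,\ tr(\beta^{-1})=0,\\ -q+1,&\beta\neq 0,\ tr(\beta^{-1})=1.\end{cases}$$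 (b) For every even $n\ge 2$ and every $\beta\in\mathbb F_q$, $$N_{DC^+(n,q)}(\beta)=q^{-1}A^+(n,q)B^+(n,q)+q^{-1}A^+(n,q)\times\begin{cases}qK(\lambda;\beta^{-1})-q^2-1,&\beta\ne0,\\ q^3-q^2-1,&\beta=0.\end{cases}$$ -/

import Mathlib

namespace SymplecticKloosterman

open Matrix

noncomputable section

/-- The symplectic group `Sp(2n, F)` over a field of characteristic two: the invertible matrices
`w` with `wᵀ J w = J`, where `J = [0, 1; 1, 0]`. -/
def Sp (F : Type*) [Field F] (n : ℕ) : Set (Matrix (Fin n ⊕ Fin n) (Fin n ⊕ Fin n) F) :=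
  {w | IsUnit w ∧ wᵀ * fromBlocks 0 1 1 0 * w = fromBlocks 0 1 1 0}

/-- The maximal parabolic subgroup `P(2n, F)`: the matrices `[A, 0; 0, ᵗA⁻¹] * [1, B; 0, 1]` with
`A` in `GL(n, F)` and `B` symmetric. -/
def P (F : Type*) [Field F] (n : ℕ) : Set (Matrix (Fin n ⊕ Fin n) (Fin n ⊕ Fin n) F) :=
  {w | ∃ (A : GL (Fin n) F) (B : Matrix (Fin n) (Fin n) F), Bᵀ = B ∧
    w = fromBlocks (A : Matrix (Fin n) (Fin n) F) 0 0 ((A⁻¹ : GL (Fin n) F) : Matrix _ _ F)ᵀ *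
      fromBlocks 1 B 0 1}

/-- The diagonal `n × n` matrix `diag(1_r, 0)`. -/
def upperId (F : Type*) [Field F] (n r : ℕ) : Matrix (Fin n) (Fin n) F :=
  diagonal fun i => if (i : ℕ) < r then 1 else 0

/-- The diagonal `n × n` matrix `diag(0, 1_{n-r})`. -/
def lowerId (F : Type*) [Field F] (n r : ℕ) : Matrix (Fin n) (Fin n) F :=
  diagonal fun i => if (i : ℕ) < r then 0 else 1

/-- The Bruhat representative `σ_r`, with rows of blocks (of sizes `r, n-r, r, n-r`)
`(0, 0, 1, 0)`, `(0, 1, 0, 0)`, `(1, 0, 0, 0)`, `(0, 0, 0, 1)`. -/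
def sigma (F : Type*) [Field F] (n r : ℕ) : Matrix (Fin n ⊕ Fin n) (Fin n ⊕ Fin n) F :=
  fromBlocks (lowerId F n r) (upperId F n r) (upperId F n r) (lowerId F n r)

/-- The double coset `P σ_r P`. -/
def PsigmaP (F : Type*) [Field F] (n r : ℕ) : Set (Matrix (Fin n ⊕ Fin n) (Fin n ⊕ Fin n) F) :=
  {w | ∃ p ∈ P F n, ∃ p' ∈ P F n, w = p * sigma F n r * p'}

/-- `DC⁻(n, q) = P σ_{n-1} P` (used for `n` odd). -/
def DCminus (F : Type*) [Field F] (n : ℕ) : Set (Matrix (Fin n ⊕ Fin n) (Fin n ⊕ Fin n) F) :=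
  PsigmaP F n (n - 1)

/-- `DC⁺(n, q) = P σ_{n-2} P` (used for `n` even, `n ≥ 2`). -/
def DCplus (F : Type*) [Field F] (n : ℕ) : Set (Matrix (Fin n ⊕ Fin n) (Fin n ⊕ Fin n) F) :=
  PsigmaP F n (n - 2)

/-- `N_S(β)`: the number of matrices in `S` of trace `β`. -/
def traceCount {F : Type*} [Field F] {n : ℕ}
    (S : Set (Matrix (Fin n ⊕ Fin n) (Fin n ⊕ Fin n) F)) (β : F) : ℕ :=
  {w | w ∈ S ∧ w.trace = β}.ncard

/-- The trace function `tr(x) = x + x² + ⋯ + x^{2^{r-1}}` of the field with `2^r` elements onto its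
prime field `{0, 1}`. -/
def tr {F : Type*} [Field F] (r : ℕ) (x : F) : F := ∑ i ∈ Finset.range r, x ^ 2 ^ i

open Classical in
/-- The canonical additive character `λ(x) = (-1)^{tr(x)}`; here `tr(x)` is `0` or `1`. -/
def canonicalChar {F : Type*} [Field F] (r : ℕ) (x : F) : ℤ := if tr r x = 0 then 1 else -1

/-- The Kloosterman sum `K(ψ; a) = ∑_{α ≠ 0} ψ(α + a α⁻¹)`. -/
def kloosterman {F : Type*} [Field F] [Fintype F] (ψ : F → ℤ) (a : F) : ℤ :=
  letI : DecidableEq F := Classical.decEq F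
  ∑ α : Fˣ, ψ ((α : F) + a * (α : F)⁻¹)

/-- The `q`-binomial coefficient `∏_{j=0}^{r-1} (q^{n-j} - 1) / (q^{r-j} - 1)`, for `r ≤ n`. -/
def qBinom (n r q : ℕ) : ℚ :=
  ∏ j ∈ Finset.range r, ((q : ℚ) ^ (n - j) - 1) / ((q : ℚ) ^ (r - j) - 1)

/-- `A⁻(n, q)`, for `n` odd (so that the divisions in the exponents are exact). -/
def Aminus (n q : ℕ) : ℚ :=
  (q : ℚ) ^ ((5 * n ^ 2 - 1) / 4) * qBinom n 1 q *
    ∏ j ∈ Finset.Icc 1 ((n - 1) / 2), ((q : ℚ) ^ (2 * j - 1) - 1)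

/-- `B⁻(n, q)`, for `n` odd. -/
def Bminus (n q : ℕ) : ℚ :=
  (q : ℚ) ^ ((n - 1) ^ 2 / 4) * ((q : ℚ) ^ n - 1) *
    ∏ j ∈ Finset.Icc 1 ((n - 1) / 2), ((q : ℚ) ^ (2 * j) - 1)

/-- `A⁺(n, q)`, for `n ≥ 2` even. -/
def Aplus (n q : ℕ) : ℚ :=
  (q : ℚ) ^ ((5 * n ^ 2 - 2 * n) / 4) * qBinom n 2 q *
    ∏ j ∈ Finset.Icc 1 ((n - 2) / 2), ((q : ℚ) ^ (2 * j - 1) - 1)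

/-- `B⁺(n, q)`, for `n ≥ 2` even. -/
def Bplus (n q : ℕ) : ℚ :=
  (q : ℚ) ^ ((n - 2) ^ 2 / 4) * ((q : ℚ) ^ n - 1) * ((q : ℚ) ^ (n - 1) - 1) *
    ∏ j ∈ Finset.Icc 1 ((n - 2) / 2), ((q : ℚ) ^ (2 * j) - 1)

/-- The trace function takes only the values `0` and `1`. -/
theorem tr_eq_zero_or_one {F : Type*} [Field F] [Fintype F] (r : ℕ)
    (hF : Fintype.card F = 2 ^ r) (x : F) : tr r x = 0 ∨ tr r x = 1 := by
  have hr : r ≠ 0 := by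
    rintro rfl
    have := Fintype.one_lt_card (α := F)
    omega
  have : CharP F 2 := by
    obtain ⟨p, hp⟩ := CharP.exists F
    obtain ⟨m, hpp, hm⟩ := FiniteField.card F p
    have h2 : p ∣ 2 ^ r := by
      rw [← hF, hm]
      exact dvd_pow_self p m.ne_zero
    have h3 : p = 2 := (Nat.prime_dvd_prime_iff_eq hpp Nat.prime_two).1 (hpp.dvd_of_dvd_pow h2)
    exact h3 ▸ hp
  have h : tr r x ^ 2 = tr r x := by
    unfold tr
    rw [sum_pow_char 2]
    have e : ∀ i ∈ Finset.range r, (x ^ 2 ^ i) ^ 2 = x ^ 2 ^ (i + 1) := by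
      intro i _
      rw [← pow_mul, ← pow_succ]
    rw [Finset.sum_congr rfl e]
    have h1 := Finset.sum_range_succ (fun i => x ^ 2 ^ i) r
    rw [Finset.sum_range_succ'] at h1
    have h2 : x ^ 2 ^ r = x := by rw [← hF, FiniteField.pow_card]
    rw [h2] at h1
    simpa using h1
  rw [sq] at h
  rcases eq_or_ne (tr r x) 0 with h0 | h0
  · exact Or.inl h0
  · exact Or.inr (mul_left_cancel₀ h0 (by rw [h, mul_one]))

theorem P_subset_Sp (F : Type*) [Field F] [CharP F 2] (n : ℕ) : P F n ⊆ Sp F n := by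
  rintro w ⟨A, B, hB, rfl⟩
  have h1 : ((A⁻¹ : GL (Fin n) F) : Matrix _ _ F) * (A : Matrix (Fin n) (Fin n) F) = 1 := by
    rw [← Units.val_mul]; simp
  generalize ((A⁻¹ : GL (Fin n) F) : Matrix (Fin n) (Fin n) F) = C at h1 ⊢
  generalize (A : Matrix (Fin n) (Fin n) F) = D at h1 ⊢
  have h2 : Dᵀ * Cᵀ = 1 := by rw [← transpose_mul, h1, transpose_one]
  have h3 : C * (D * B) = B := by rw [← Matrix.mul_assoc, h1, Matrix.one_mul]
  have h4 : D.det * C.det = 1 := by rw [mul_comm, ← det_mul, h1, det_one]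
  have h5 : B + B = 0 := by
    ext i j
    exact CharTwo.add_self_eq_zero _
  refine ⟨?_, ?_⟩
  · rw [isUnit_iff_isUnit_det, det_mul, det_fromBlocks_zero₂₁, det_fromBlocks_zero₂₁,
      det_transpose, h4]
    simp
  · simp [fromBlocks_transpose, fromBlocks_multiply, hB, Matrix.mul_assoc, h1, h2, h3, h5]

theorem sigma_mem_Sp (F : Type*) [Field F] (n r : ℕ) : sigma F n r ∈ Sp F n := by
  have e1 : upperId F n r * upperId F n r + lowerId F n r * lowerId F n r = 1 := by
    simp only [upperId, lowerId, diagonal_mul_diagonal, diagonal_add, ← diagonal_one]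
    congr 1; ext i; split_ifs <;> simp
  have e2 : upperId F n r * lowerId F n r = 0 := by
    simp only [upperId, lowerId, diagonal_mul_diagonal, ← diagonal_zero]
    congr 1; ext i; split_ifs <;> simp
  have e3 : lowerId F n r * upperId F n r = 0 := by
    simp only [upperId, lowerId, diagonal_mul_diagonal, ← diagonal_zero]
    congr 1; ext i; split_ifs <;> simp
  have e4 : (upperId F n r)ᵀ = upperId F n r := diagonal_transpose _
  have e5 : (lowerId F n r)ᵀ = lowerId F n r := diagonal_transpose _
  have e6 := (add_comm _ _).trans e1
  have h : sigma F n r * sigma F n r = 1 := by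
    simp [sigma, fromBlocks_multiply, e1, e2, e3, e6]
  refine ⟨IsUnit.of_mul_eq_one _ h, ?_⟩
  simp [sigma, fromBlocks_multiply, fromBlocks_transpose, e1, e2, e3, e4, e5, e6]

/-- The double cosets lie in the symplectic group. -/
theorem PsigmaP_subset_Sp (F : Type*) [Field F] [CharP F 2] (n r : ℕ) :
    PsigmaP F n r ⊆ Sp F n := by
  have key : ∀ a ∈ Sp F n, ∀ b ∈ Sp F n, a * b ∈ Sp F n := by
    rintro a ⟨ha, ha'⟩ b ⟨hb, hb'⟩
    refine ⟨ha.mul hb, ?_⟩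
    rw [transpose_mul]
    calc bᵀ * aᵀ * fromBlocks 0 1 1 0 * (a * b) = bᵀ * (aᵀ * fromBlocks 0 1 1 0 * a) * b := by
          simp only [Matrix.mul_assoc]
      _ = fromBlocks 0 1 1 0 := by rw [ha', hb']
  rintro w ⟨p, hp, p', hp', rfl⟩
  exact key _ (key _ (P_subset_Sp F n hp) _ (sigma_mem_Sp F n r)) _ (P_subset_Sp F n hp')

end

end SymplecticKloosterman

/-! The trace is a class function, so on a double coset `P σ P` its distribution can be read off
from the single coset `P σ`: counting pairs `(p, p')` with `Tr (p σ p') = Tr (p' p σ) = β` in two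
ways gives `|{w ∈ PσP : Tr w = β}| · |P ∩ σ⁻¹Pσ| = |P| · |{p ∈ P : Tr (pσ) = β}|`
(`card_doubleCoset_fiber`).

Split indices into blocks of sizes `s` and `m = n - s`. For `p` given by `(A, B)`, the trace of `pσ`
is `tr A₂₂ + tr (A⁻¹)₂₂ + tr (AB)₁₁`. For fixed `A` the last term is a linear functional of the
symmetric matrix `B`. If it is nonzero, the trace is equidistributed over the field. In
characteristic two it vanishes exactly when `A₁₂ = 0` and `A₁₁` is alternating
(`forall_trace_toBlocks₁₁_mul_eq_zero_iff`). Only these degenerate `A` make the count depend on `β`,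
and their contribution is the number of nonsingular alternating `s × s` matrices times the number of
`D` in `GL(m, q)` with `tr D + tr D⁻¹ = β`, up to a power of `q` (`card_parabolic_trace_eq`).

In the two cases `s` is even and `m` is 1 or 2. For `m = 1`, the equation `a + a⁻¹ = β` is quadratic
and Artin–Schreier theory decides it by `tr (β⁻¹)`. For `m = 2`, the condition involves only the
trace and determinant of `D`; counting matrices with a given characteristic polynomial and summing
over the determinant produces the Kloosterman sum. The remaining factors are the orders of `GL`, the
number of symmetric matrices and the number of nonsingular alternating matrices (`altCount_eq`),
which combine into the stated constants. -/

namespace SymplecticKloosterman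

open Matrix

/-! ### Quadratic equations in characteristic two and the counts for `GL(1)` and `GL(2)` -/

section FieldCounts

variable {F : Type*} [Field F]

theorem charP_two_of_card [Fintype F] {r : ℕ} (hF : Fintype.card F = 2 ^ r) : CharP F 2 := by
  obtain ⟨p, hp⟩ := CharP.exists F
  obtain ⟨m, hpp, hm⟩ := FiniteField.card F p
  have h2 : p ∣ 2 ^ r := by
    rw [← hF, hm]
    exact dvd_pow_self p m.ne_zero
  have h3 : p = 2 := (Nat.prime_dvd_prime_iff_eq hpp Nat.prime_two).1 (hpp.dvd_of_dvd_pow h2)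
  exact h3 ▸ hp

theorem tr_add [CharP F 2] (r : ℕ) (x y : F) : tr r (x + y) = tr r x + tr r y := by
  simp only [tr, add_pow_char_pow, Finset.sum_add_distrib]

theorem tr_sq [CharP F 2] [Fintype F] {r : ℕ} (hF : Fintype.card F = 2 ^ r) (x : F) :
    tr r (x ^ 2) = tr r x := by
  have h1 : tr r (x ^ 2) = tr r x ^ 2 := by
    simp only [tr]
    rw [sum_pow_char 2]
    exact Finset.sum_congr rfl fun i _ => by rw [← pow_mul, ← pow_mul, mul_comm]
  rw [h1]
  rcases tr_eq_zero_or_one r hF x with h | h <;> simp [h]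

theorem canonicalChar_sq [CharP F 2] [Fintype F] {r : ℕ} (hF : Fintype.card F = 2 ^ r) (x : F) :
    canonicalChar r (x ^ 2) = canonicalChar r x := by
  unfold canonicalChar
  rw [tr_sq hF]

/-- The trace is a polynomial of degree at most `2 ^ (r - 1)`, nonzero because its coefficient at
`X` is 1, so it has at most that many roots. -/
theorem card_tr_eq_zero_le [Fintype F] {r : ℕ} (hr : 0 < r) :
    Nat.card {x : F // tr r x = 0} ≤ 2 ^ (r - 1) := by
  classical
  let p : Polynomial F := ∑ i ∈ Finset.range r, Polynomial.X ^ 2 ^ i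
  have hdeg : p.natDegree ≤ 2 ^ (r - 1) := by
    refine Polynomial.natDegree_sum_le_of_forall_le _ _ fun i hi => ?_
    rw [Polynomial.natDegree_X_pow]
    exact Nat.pow_le_pow_right (by norm_num) (by have := Finset.mem_range.1 hi; omega)
  have hp : p ≠ 0 := by
    intro h
    have h1 : p.coeff 1 = 1 := by
      simp only [p, Polynomial.finsetSum_coeff, Polynomial.coeff_X_pow]
      rw [Finset.sum_eq_single 0]
      · simp
      · intro i _ hi
        have : 1 < 2 ^ i := Nat.one_lt_two_pow hi
        rw [if_neg (by omega)]
      · simp; omega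
    simp [h] at h1
  have hsub : (Finset.univ.filter fun x : F => tr r x = 0) ⊆ p.roots.toFinset := by
    intro x hx
    simp only [Finset.mem_filter, Finset.mem_univ, true_and] at hx
    simp only [Multiset.mem_toFinset, Polynomial.mem_roots hp, Polynomial.IsRoot.def, p,
      Polynomial.eval_finsetSum, Polynomial.eval_pow, Polynomial.eval_X]
    exact hx
  rw [Nat.card_eq_fintype_card, Fintype.card_subtype]
  exact (Finset.card_le_card hsub).trans
    ((Multiset.toFinset_card_le _).trans ((Polynomial.card_roots' p).trans hdeg))

/-- The Artin–Schreier map `x ↦ x² + x`. -/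
def artinSchreier (F : Type*) [Field F] [CharP F 2] : F →+ F where
  toFun x := x ^ 2 + x
  map_zero' := by simp
  map_add' x y := by rw [add_pow_char]; ring

theorem card_ker_artinSchreier [CharP F 2] [Finite F] : Nat.card (artinSchreier F).ker = 2 := by
  classical
  have : ((artinSchreier F).ker : Set F) = {0, 1} := by
    ext x
    simp only [SetLike.mem_coe, AddMonoidHom.mem_ker, artinSchreier, AddMonoidHom.coe_mk,
      ZeroHom.coe_mk, Set.mem_insert_iff, Set.mem_singleton_iff]
    rw [show x ^ 2 + x = x * (x + 1) by ring, mul_eq_zero, CharTwo.add_eq_zero]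
  rw [← SetLike.coe_sort_coe, this, Nat.card_coe_set_eq, Set.ncard_pair zero_ne_one]

/-- Frobenius invariance of the trace puts the image of `x ↦ x² + x` inside the trace-zero elements.
The kernel has two elements, so the image has `q / 2`, which is also the upper bound for the number
of trace-zero elements; the two sets coincide. -/
theorem exists_artinSchreier_iff [CharP F 2] [Fintype F] {r : ℕ} (hr : 0 < r)
    (hF : Fintype.card F = 2 ^ r) (c : F) : (∃ x : F, x ^ 2 + x = c) ↔ tr r c = 0 := by
  have hsub : ((artinSchreier F).range : Set F) ⊆ {x | tr r x = 0} := by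
    rintro _ ⟨x, rfl⟩
    simp only [artinSchreier, AddMonoidHom.coe_mk, ZeroHom.coe_mk, Set.mem_ofPred_eq, tr_add,
      tr_sq hF, CharTwo.add_self_eq_zero]
  have hcard : Nat.card (artinSchreier F).range * 2 = 2 ^ r := by
    rw [mul_comm, ← hF, ← Nat.card_eq_fintype_card, ← card_ker_artinSchreier (F := F),
      ← Nat.card_congr (QuotientAddGroup.quotientKerEquivRange (artinSchreier F)).toEquiv]
    exact (artinSchreier F).ker.card_mul_index
  have hle : Set.ncard {x : F | tr r x = 0} ≤ Set.ncard ((artinSchreier F).range : Set F) := by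
    have h1 := card_tr_eq_zero_le (F := F) hr
    have h2 : 2 ^ r = 2 ^ (r - 1) * 2 := by rw [← pow_succ]; congr 1; omega
    have h3 : Set.ncard {x : F | tr r x = 0} = Nat.card {x : F // tr r x = 0} :=
      (Nat.card_coe_set_eq _).symm
    have h4 : Set.ncard ((artinSchreier F).range : Set F) = Nat.card (artinSchreier F).range :=
      (Nat.card_coe_set_eq _).symm
    omega
  have heq := Set.eq_of_subset_of_ncard_le hsub hle
  have := Set.ext_iff.1 heq c
  simpa [artinSchreier] using this

theorem card_artinSchreier_eq [CharP F 2] [Fintype F] {r : ℕ} (hr : 0 < r)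
    (hF : Fintype.card F = 2 ^ r) (c : F) :
    (Nat.card {x : F // x ^ 2 + x = c} : ℤ) = 1 + canonicalChar r c := by
  have hiff := exists_artinSchreier_iff hr hF c
  unfold canonicalChar
  split_ifs with h
  · obtain ⟨y, hy⟩ := hiff.2 h
    have e : {x : F // x ^ 2 + x = c} ≃ (artinSchreier F).ker :=
      (Equiv.addRight (-y)).subtypeEquiv fun x => by
        rw [Equiv.coe_addRight, AddMonoidHom.mem_ker, map_add, map_neg, add_neg_eq_zero, ← hy]
        simp [artinSchreier]
    rw [Nat.card_congr e, card_ker_artinSchreier]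
    norm_num
  · have : IsEmpty {x : F // x ^ 2 + x = c} := ⟨fun x => h (hiff.1 ⟨x.1, x.2⟩)⟩
    simp

/-- The substitution `x = t y` gives `y² + y = d / t²`. -/
theorem card_quadratic_eq_zero [CharP F 2] [Fintype F] {r : ℕ} (hr : 0 < r)
    (hF : Fintype.card F = 2 ^ r) {t : F} (ht : t ≠ 0) (d : F) :
    (Nat.card {x : F // x ^ 2 + t * x + d = 0} : ℤ) = 1 + canonicalChar r (d / t ^ 2) := by
  rw [← card_artinSchreier_eq hr hF]
  norm_cast
  refine Nat.card_congr ((Equiv.mulLeft₀ t⁻¹ (inv_ne_zero ht)).subtypeEquiv fun x => ?_)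
  simp only [Equiv.mulLeft₀_apply]
  rw [CharTwo.add_eq_zero, eq_div_iff (pow_ne_zero 2 ht)]
  field_simp

theorem card_sq_add_eq_zero [CharP F 2] [Finite F] (d : F) :
    Nat.card {x : F // x ^ 2 + d = 0} = 1 := by
  have hinj : Function.Injective fun x : F => x ^ 2 := fun x y h => by
    have : (x + y) ^ 2 = 0 := by
      rw [add_pow_char]
      exact CharTwo.add_eq_zero.2 h
    exact CharTwo.add_eq_zero.1 (pow_eq_zero_iff two_ne_zero |>.1 this)
  obtain ⟨y, hy⟩ := (Finite.injective_iff_surjective.1 hinj) d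
  rw [Nat.card_eq_one_iff_exists]
  refine ⟨⟨y, CharTwo.add_eq_zero.2 hy⟩, fun x => Subtype.ext (hinj ?_)⟩
  exact (CharTwo.add_eq_zero.1 x.2).trans hy.symm

theorem card_unit_add_inv_eq_zero [CharP F 2] [Finite F] :
    Nat.card {a : F // a ≠ 0 ∧ a + a⁻¹ = 0} = 1 := by
  rw [← card_sq_add_eq_zero (1 : F)]
  refine Nat.card_congr (Equiv.subtypeEquivRight fun a => ?_)
  constructor
  · rintro ⟨h0, h⟩
    field_simp at h
    simpa using h
  · intro h
    have h0 : a ≠ 0 := by rintro rfl; simp at h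
    refine ⟨h0, ?_⟩
    field_simp
    simpa using h

/-- Clearing denominators gives `a² + βa + 1 = 0`, whose roots are nonzero automatically. Its
invariant is `1 / β²`, and Frobenius invariance of the character replaces it by `β⁻¹`. -/
theorem card_unit_add_inv_eq [CharP F 2] [Fintype F] {r : ℕ} (hr : 0 < r)
    (hF : Fintype.card F = 2 ^ r) {β : F} (hβ : β ≠ 0) :
    (Nat.card {a : F // a ≠ 0 ∧ a + a⁻¹ = β} : ℤ) = 1 + canonicalChar r β⁻¹ := by
  rw [← canonicalChar_sq hF, show β⁻¹ ^ 2 = 1 / β ^ 2 by field_simp,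
    ← card_quadratic_eq_zero hr hF hβ]
  norm_cast
  refine Nat.card_congr (Equiv.subtypeEquivRight fun a => ?_)
  constructor
  · rintro ⟨h0, h⟩
    field_simp at h
    rw [add_right_comm, h, mul_comm]
    exact CharTwo.add_self_eq_zero _
  · intro h
    have h0 : a ≠ 0 := by rintro rfl; simp at h
    refine ⟨h0, ?_⟩
    rw [add_right_comm, CharTwo.add_eq_zero] at h
    field_simp
    rw [h, mul_comm]

theorem card_mul_eq [Fintype F] [DecidableEq F] (e : F) :
    (Nat.card {x : F × F // x.1 * x.2 = e} : ℤ) =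
      Fintype.card F - 1 + if e = 0 then (Fintype.card F : ℤ) else 0 := by
  have h1 : Nat.card {x : F × F // x.1 * x.2 = e} = ∑ b : F, Nat.card {c : F // b * c = e} := by
    rw [← Nat.card_sigma]
    exact Nat.card_congr
      { toFun := fun x => ⟨x.1.1, x.1.2, x.2⟩
        invFun := fun x => ⟨(x.1, x.2.1), x.2.2⟩
        left_inv := fun _ => rfl
        right_inv := fun _ => rfl }
  have h2 : ∀ b : F, (Nat.card {c : F // b * c = e} : ℤ) =
      if b = 0 then (if e = 0 then (Fintype.card F : ℤ) else 0) else 1 := by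
    intro b
    split_ifs with hb he
    · subst hb he
      simp
    · subst hb
      have : IsEmpty {c : F // 0 * c = e} := ⟨fun c => he (by simpa using c.2.symm)⟩
      rw [Nat.card_of_isEmpty, Nat.cast_zero]
    · norm_cast
      rw [Nat.card_eq_one_iff_exists]
      exact ⟨⟨b⁻¹ * e, mul_inv_cancel_left₀ hb e⟩, fun c => Subtype.ext
        ((eq_inv_mul_iff_mul_eq₀ hb).2 c.2)⟩
  rw [h1, Nat.cast_sum, Finset.sum_congr rfl fun b _ => h2 b,
    ← Finset.add_sum_erase _ _ (Finset.mem_univ (0 : F)),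
    Finset.sum_congr rfl fun b hb => if_neg (Finset.ne_of_mem_erase hb)]
  rw [if_pos rfl, Finset.sum_const, Finset.card_erase_of_mem (Finset.mem_univ _),
    Finset.card_univ, nsmul_eq_mul, mul_one, Nat.cast_sub Fintype.card_pos, Nat.cast_one]
  ring

/-- With upper left entry `a` the other diagonal entry is `t - a`, and the off-diagonal entries must
have product `a² + ta + d`. That equation has `q - 1` solutions, and `q` more when `a` is a root of
the characteristic polynomial. -/
theorem card_trace_det_eq [CharP F 2] [Fintype F] (t d : F) :
    (Nat.card {A : Matrix (Fin 2) (Fin 2) F // A.trace = t ∧ A.det = d} : ℤ) =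
      Fintype.card F * (Fintype.card F - 1) +
        Fintype.card F * Nat.card {x : F // x ^ 2 + t * x + d = 0} := by
  classical
  have e : {A : Matrix (Fin 2) (Fin 2) F // A.trace = t ∧ A.det = d} ≃
      Σ a : F, {x : F × F // x.1 * x.2 = a ^ 2 + t * a + d} :=
    { toFun := fun A => ⟨A.1 0 0, ⟨(A.1 0 1, A.1 1 0), by
        obtain ⟨A, h1, h2⟩ := A
        rw [trace_fin_two] at h1
        rw [det_fin_two] at h2
        subst h1 h2
        linear_combination
          CharTwo.add_self_eq_zero (A 0 1 * A 1 0) - CharTwo.add_self_eq_zero (A 0 0 ^ 2)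
            - CharTwo.add_self_eq_zero (A 0 0 * A 1 1)⟩⟩
      invFun := fun x => ⟨!![x.1, x.2.1.1; x.2.1.2, t - x.1], by simp [trace_fin_two], by
        have := x.2.2
        rw [det_fin_two]
        simp only [of_apply, cons_val', cons_val_zero, cons_val_one, cons_val_fin_one]
        linear_combination -this - CharTwo.add_self_eq_zero (x.1 ^ 2)
          - CharTwo.add_self_eq_zero d⟩
      left_inv := fun A => by
        obtain ⟨A, h1, h2⟩ := A
        rw [trace_fin_two] at h1
        apply Subtype.ext
        ext i j
        fin_cases i <;> fin_cases j <;> simp [← h1]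
      right_inv := fun x => by simp }
  rw [Nat.card_congr e, Nat.card_sigma, Nat.cast_sum,
    Finset.sum_congr rfl fun a _ => card_mul_eq _, Finset.sum_add_distrib, Finset.sum_const,
    Nat.card_eq_fintype_card (α := {x : F // x ^ 2 + t * x + d = 0}), Fintype.card_subtype,
    Finset.sum_ite, Finset.sum_const, Finset.sum_const_zero, Finset.card_univ]
  simp only [nsmul_eq_mul]
  ring

theorem trace_inv_fin_two (A : Matrix (Fin 2) (Fin 2) F) : A⁻¹.trace = A.det⁻¹ * A.trace := by
  rw [inv_def, trace_smul, Ring.inverse_eq_inv', adjugate_fin_two, trace_fin_two, trace_fin_two,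
    smul_eq_mul]
  simp [add_comm]

/-- Since `tr A⁻¹ = tr A / det A`, the condition on `A` depends only on `t = tr A` and `d = det A`.
-/
theorem card_gl_two_trace_add_trace_inv [CharP F 2] [Fintype F] [DecidableEq F] (β : F) :
    (Nat.card {A : Matrix (Fin 2) (Fin 2) F // IsUnit A.det ∧ A.trace + A⁻¹.trace = β} : ℤ) =
      ∑ d : Fˣ, ∑ t : F, if t * (1 + (d : F)⁻¹) = β then
        (Fintype.card F * (Fintype.card F - 1) +
        Fintype.card F * Nat.card {x : F // x ^ 2 + t * x + d = 0} : ℤ) else 0 := by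
  have e : {A : Matrix (Fin 2) (Fin 2) F // IsUnit A.det ∧ A.trace + A⁻¹.trace = β} ≃
      Σ d : Fˣ, Σ t : F, {A : Matrix (Fin 2) (Fin 2) F // t * (1 + (d : F)⁻¹) = β ∧
        A.trace = t ∧ A.det = d} :=
    { toFun := fun A => ⟨A.2.1.unit, A.1.trace, A.1, by
        refine Eq.trans ?_ A.2.2
        rw [IsUnit.unit_spec, mul_add, mul_one, mul_comm _ (det _)⁻¹, ← trace_inv_fin_two],
        rfl, rfl⟩
      invFun := fun x => ⟨x.2.2.1, by rw [x.2.2.2.2.2]; exact x.1.isUnit, by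
        refine Eq.trans ?_ x.2.2.2.1
        rw [trace_inv_fin_two, x.2.2.2.2.2, x.2.2.2.2.1]; ring⟩
      left_inv := fun A => rfl
      right_inv := by
        rintro ⟨d, t, A, h, h1, h2⟩
        obtain rfl := h1
        have : IsUnit A.det := by rw [h2]; exact d.isUnit
        obtain rfl : this.unit = d := Units.ext h2
        rfl }
  rw [Nat.card_congr e, Nat.card_sigma, Nat.cast_sum]
  refine Finset.sum_congr rfl fun d _ => ?_
  rw [Nat.card_sigma, Nat.cast_sum]
  refine Finset.sum_congr rfl fun t _ => ?_
  split_ifs with h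
  · rw [← card_trace_det_eq]
    simp [h]
  · have : IsEmpty {A : Matrix (Fin 2) (Fin 2) F // t * (1 + (d : F)⁻¹) = β ∧
        A.trace = t ∧ A.det = d} := ⟨fun A => h A.2.1⟩
    simp

theorem one_add_inv_eq_zero_iff [CharP F 2] (d : Fˣ) : 1 + (d : F)⁻¹ = 0 ↔ d = 1 := by
  rw [CharTwo.add_eq_zero, eq_comm, inv_eq_one, Units.val_eq_one]

theorem kloosterman_sq [CharP F 2] [Fintype F] {r : ℕ} (hF : Fintype.card F = 2 ^ r) (a : F) :
    kloosterman (canonicalChar r) (a ^ 2) = kloosterman (canonicalChar r) a := by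
  classical
  have hinj : Function.Injective fun x : Fˣ => x ^ 2 := fun x y h => by
    have h' : (x : F) ^ 2 = (y : F) ^ 2 := by exact_mod_cast congrArg Units.val h
    have : ((x : F) + y) ^ 2 = 0 := by
      rw [add_pow_char]
      exact CharTwo.add_eq_zero.2 h'
    exact Units.ext (CharTwo.add_eq_zero.1 (pow_eq_zero_iff two_ne_zero |>.1 this))
  have hbij := Finite.injective_iff_bijective.1 hinj
  unfold kloosterman
  refine Eq.symm ?_
  convert hbij.sum_comp (fun α : Fˣ => canonicalChar r ((α : F) + a ^ 2 * (α : F)⁻¹)) using 1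
  refine Finset.sum_congr (by ext; simp) fun α _ => ?_
  rw [← canonicalChar_sq hF, add_pow_char, mul_pow, inv_pow, Units.val_pow_eq_pow_val]

theorem canonicalChar_zero (r : ℕ) : canonicalChar r (0 : F) = 1 := by
  simp [canonicalChar, tr]

theorem card_gl_two_trace_add_trace_inv_of_ne_zero [CharP F 2] [Fintype F] {r : ℕ} (hr : 0 < r)
    (hF : Fintype.card F = 2 ^ r) {β : F} (hβ : β ≠ 0) :
    (Nat.card {A : Matrix (Fin 2) (Fin 2) F // IsUnit A.det ∧ A.trace + A⁻¹.trace = β} : ℤ) =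
      (Fintype.card F : ℤ) ^ 2 * (Fintype.card F - 2) +
        Fintype.card F * (kloosterman (canonicalChar r) β⁻¹ - 1) := by
  classical
  set q : ℤ := (Fintype.card F : ℤ) with hqdef
  rw [card_gl_two_trace_add_trace_inv]
  -- For `d ≠ 1` the trace `t = β / (1 + d⁻¹)` is forced and nonzero. For `d = 1` there is no
  -- solution; the general expression, equal to `q² + q` there, is kept and subtracted so that the
  -- character sum runs over all units.
  have hinner : ∀ d : Fˣ, (∑ t : F, if t * (1 + (d : F)⁻¹) = β then
        (q * (q - 1) + q * Nat.card {x : F // x ^ 2 + t * x + d = 0} : ℤ) else 0) =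
      (q ^ 2 + q * canonicalChar r (((d : F) + (d : F)⁻¹) / β ^ 2)) -
        if d = 1 then q ^ 2 + q else 0 := by
    intro d
    split_ifs with hd
    · subst hd
      simp only [Units.val_one, inv_one, CharTwo.add_self_eq_zero, mul_zero, hβ.symm, if_false,
        Finset.sum_const_zero, zero_div, canonicalChar_zero]
      ring
    · have h0 : 1 + (d : F)⁻¹ ≠ 0 := fun h => hd ((one_add_inv_eq_zero_iff d).1 h)
      have ht : β / (1 + (d : F)⁻¹) ≠ 0 := div_ne_zero hβ h0
      simp only [← eq_div_iff h0, Finset.sum_ite_eq', Finset.mem_univ, if_true]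
      rw [card_quadratic_eq_zero hr hF ht,
        show (d : F) / (β / (1 + (d : F)⁻¹)) ^ 2 = ((d : F) + (d : F)⁻¹) / β ^ 2 by
          rw [div_pow, add_pow_char, div_div_eq_mul_div, one_pow, mul_add]
          congr 2
          · ring
          · field_simp]
      ring
  have hK : kloosterman (canonicalChar r) β⁻¹ =
      ∑ d : Fˣ, canonicalChar r (((d : F) + (d : F)⁻¹) / β ^ 2) := by
    -- The substitution `d = β² α` yields the Kloosterman sum at `β⁻⁴`, which is two Frobenius steps
    -- away from `β⁻¹`.
    rw [← kloosterman_sq hF, ← kloosterman_sq hF]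
    unfold kloosterman
    convert (Equiv.sum_comp (Equiv.mulRight ((Units.mk0 β hβ)⁻¹ ^ 2))
      fun α : Fˣ => canonicalChar r ((α : F) + (β⁻¹ ^ 2) ^ 2 * (α : F)⁻¹)).symm using 1
    refine Finset.sum_congr (by ext; simp) fun α _ => ?_
    congr 1
    simp only [Equiv.coe_mulRight, Units.val_mul, Units.val_pow_eq_pow_val, Units.val_inv_eq_inv_val,
      Units.val_mk0]
    field_simp
  rw [Finset.sum_congr rfl fun d _ => hinner d, Finset.sum_sub_distrib, Finset.sum_add_distrib,
    ← Finset.mul_sum, ← hK, Finset.sum_const, Finset.card_univ, Fintype.card_units,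
    Finset.sum_ite_eq', if_pos (Finset.mem_univ _), nsmul_eq_mul, Nat.cast_sub Fintype.card_pos,
    ← hqdef]
  push_cast
  ring

/-- In a pair `(t, x)` the root `x` is any nonzero element, and it determines `t`. -/
theorem sum_card_quadratic_eq_zero [CharP F 2] [Fintype F] :
    (∑ t : F, (Nat.card {x : F // x ^ 2 + t * x + 1 = 0} : ℤ)) = Fintype.card F - 1 := by
  classical
  have e : (Σ t : F, {x : F // x ^ 2 + t * x + 1 = 0}) ≃ Fˣ :=
    { toFun := fun p => Units.mk0 p.2.1 fun h => by simpa [h] using p.2.2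
      invFun := fun x => ⟨-((x : F) + (x : F)⁻¹), x, by field_simp; ring⟩
      left_inv := by
        rintro ⟨t, x, h⟩
        have hx : x ≠ 0 := fun h0 => by simp [h0] at h
        obtain rfl : t = -(x + x⁻¹) := by
          field_simp
          linear_combination h
        rfl
      right_inv := fun x => Units.ext rfl }
  have h1 : ∑ t : F, Nat.card {x : F // x ^ 2 + t * x + 1 = 0} = Fintype.card F - 1 := by
    rw [← Nat.card_sigma, Nat.card_congr e, Nat.card_eq_fintype_card, Fintype.card_units]
  have h2 := congrArg (Nat.cast : ℕ → ℤ) h1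
  rw [Nat.cast_sub Fintype.card_pos] at h2
  exact_mod_cast h2

theorem card_gl_two_trace_add_trace_inv_zero [CharP F 2] [Fintype F] :
    (Nat.card {A : Matrix (Fin 2) (Fin 2) F // IsUnit A.det ∧ A.trace + A⁻¹.trace = 0} : ℤ) =
      2 * (Fintype.card F : ℤ) ^ 3 - 2 * (Fintype.card F : ℤ) ^ 2 - Fintype.card F := by
  classical
  set q : ℤ := (Fintype.card F : ℤ) with hqdef
  rw [card_gl_two_trace_add_trace_inv]
  have hinner : ∀ d : Fˣ, (∑ t : F, if t * (1 + (d : F)⁻¹) = 0 then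
        (q * (q - 1) + q * Nat.card {x : F // x ^ 2 + t * x + d = 0} : ℤ) else 0) =
      q ^ 2 + if d = 1 then q * (q ^ 2 - 1) - q ^ 2 else 0 := by
    intro d
    -- For `d = 1` every trace `t` is allowed; for `d ≠ 1` only `t = 0`, where `x² + d` has a single
    -- root.
    split_ifs with hd
    · subst hd
      simp only [Units.val_one, inv_one, CharTwo.add_self_eq_zero, mul_zero, if_true]
      rw [Finset.sum_add_distrib, ← Finset.mul_sum Finset.univ (fun t : F =>
        (Nat.card {x : F // x ^ 2 + t * x + 1 = 0} : ℤ)), sum_card_quadratic_eq_zero, Finset.sum_const,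
        Finset.card_univ, nsmul_eq_mul, ← hqdef]
      ring
    · have h0 : 1 + (d : F)⁻¹ ≠ 0 := fun h => hd ((one_add_inv_eq_zero_iff d).1 h)
      simp only [mul_eq_zero, h0, or_false, Finset.sum_ite_eq', Finset.mem_univ, if_true, zero_mul,
        add_zero, card_sq_add_eq_zero]
      push_cast
      ring
  rw [Finset.sum_congr rfl fun d _ => hinner d, Finset.sum_add_distrib, Finset.sum_const,
    Finset.card_univ, Fintype.card_units, Finset.sum_ite_eq', if_pos (Finset.mem_univ _),
    nsmul_eq_mul, Nat.cast_sub Fintype.card_pos, ← hqdef]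
  push_cast
  ring

end FieldCounts

/-! ### Fibres of a class function on a double coset -/

section DoubleCoset

/-- Both sides count the pairs `(h, h')` in `H × H` with `f (h g h') = β`. Cyclicity turns the
condition into `f (h' h g) = β`, so `h'` is free. Conversely, each `x` in the double coset has as
many factorizations as there are elements in `H ∩ g⁻¹Hg`. -/
theorem card_doubleCoset_fiber {G X : Type*} [Group G] [Finite G] (H : Subgroup G) (g : G)
    (f : G → X) (hf : ∀ x y, f (x * y) = f (y * x)) (β : X) :
    Nat.card {x : G // (∃ h ∈ H, ∃ h' ∈ H, x = h * g * h') ∧ f x = β} *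
        Nat.card {k : H // g * k * g⁻¹ ∈ H} =
      Nat.card H * Nat.card {h : H // f (h * g) = β} := by
  have h1 : Nat.card {p : H × H // f (p.1 * g * p.2) = β} =
      Nat.card H * Nat.card {h : H // f (h * g) = β} := by
    rw [← Nat.card_prod]
    exact Nat.card_congr
      { toFun := fun p => (p.1.2, ⟨p.1.2 * p.1.1, by
          have := p.2
          rw [hf, ← mul_assoc] at this
          simpa using this⟩)
        invFun := fun p => ⟨(p.1⁻¹ * p.2.1, p.1), by
          have := p.2.2
          rw [hf, ← mul_assoc]
          simpa using this⟩
        left_inv := fun p => by simp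
        right_inv := fun p => by simp }
  rw [← h1, ← Nat.card_prod]
  have hch : ∀ x : {x : G // (∃ h ∈ H, ∃ h' ∈ H, x = h * g * h') ∧ f x = β},
      ∃ p : H × H, (x : G) = p.1 * g * p.2 := by
    rintro ⟨x, ⟨h, hh, h', hh', rfl⟩, _⟩
    exact ⟨(⟨h, hh⟩, ⟨h', hh'⟩), rfl⟩
  choose c hc using hch
  -- All factorizations of `x` arise from the chosen one `(h, h')` as `(h · g k g⁻¹, k⁻¹ h')`.
  refine Nat.card_eq_of_bijective (fun z => ⟨((c z.1).1 * ⟨_, z.2.2⟩, z.2.1⁻¹ * (c z.1).2), ?_⟩)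
    ⟨?_, ?_⟩
  · have := z.1.2.2
    rw [hc z.1] at this
    refine Eq.trans ?_ this
    congr 1
    simp [mul_assoc]
  · have hx : ∀ z : {x : G // (∃ h ∈ H, ∃ h' ∈ H, x = h * g * h') ∧ f x = β} ×
        {k : H // g * k * g⁻¹ ∈ H}, (((c z.1).1 * ⟨_, z.2.2⟩ : H) : G) * g *
          ((z.2.1⁻¹ * (c z.1).2 : H) : G) = z.1 := fun z => by
      rw [hc z.1]
      simp [mul_assoc]
    intro z w hzw
    have h1 := congrArg Prod.fst (congrArg Subtype.val hzw)
    have h2 := congrArg Prod.snd (congrArg Subtype.val hzw)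
    dsimp only at h1 h2
    have h3 : z.1 = w.1 := Subtype.ext (by rw [← hx z, ← hx w, h1, h2])
    rw [h3, mul_left_inj, _root_.inv_inj] at h2
    exact Prod.ext h3 (Subtype.ext h2)
  · rintro ⟨⟨h, h'⟩, hβ⟩
    let x : {x : G // (∃ h ∈ H, ∃ h' ∈ H, x = h * g * h') ∧ f x = β} :=
      ⟨h * g * h', ⟨h, h.2, h', h'.2, rfl⟩, hβ⟩
    have hx : (h : G) * g * h' = (c x).1 * g * (c x).2 := hc x
    have hk : g * ((c x).2 * h'⁻¹ : H) * g⁻¹ = ((c x).1⁻¹ * h : H) := by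
      simp only [Subgroup.coe_mul, Subgroup.coe_inv]
      rw [eq_inv_mul_iff_mul_eq, ← mul_assoc, ← mul_assoc, ← mul_assoc, ← hx]
      group
    refine ⟨(x, ⟨(c x).2 * h'⁻¹, by rw [hk]; exact SetLike.coe_mem _⟩), Subtype.ext (Prod.ext ?_ ?_)⟩
    · apply Subtype.ext
      simp only [Subgroup.coe_mul] at hk ⊢
      rw [hk]
      simp
    · simp

end DoubleCoset

/-! ### Counting symmetric and block triangular matrices -/

section Blocks

/-- The number of symmetric matrices. -/
theorem card_isSymm {F ι : Type*} [Fintype F] [Fintype ι] :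
    Nat.card {B : Matrix ι ι F // Bᵀ = B} =
      Fintype.card F ^ ((Fintype.card ι + 1).choose 2) := by
  have e : {B : Matrix ι ι F // Bᵀ = B} ≃ (Sym2 ι → F) :=
    { toFun := fun B => Sym2.lift ⟨fun i j => B.1 i j, fun i j => by
        conv_lhs => rw [← B.2]
        rfl⟩
      invFun := fun f => ⟨of fun i j => f s(i, j), by ext i j; simp [Sym2.eq_swap]⟩
      left_inv := fun B => rfl
      right_inv := fun f => by
        ext x
        induction x
        rfl }
  rw [Nat.card_congr e, Nat.card_fun, Nat.card_eq_fintype_card, Nat.card_eq_fintype_card, Sym2.card]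

variable {F : Type*} [Field F] {ι κ : Type*} [Fintype ι] [Fintype κ]

theorem card_matrix (ι κ F : Type*) [Fintype ι] [Fintype κ] [Fintype F] :
    Nat.card (Matrix ι κ F) = Fintype.card F ^ (Fintype.card ι * Fintype.card κ) := by
  rw [Matrix, Nat.card_fun, Nat.card_fun]
  simp only [Nat.card_eq_fintype_card]
  rw [← pow_mul, mul_comm]

theorem card_isSymm_toBlocks₁₁_eq_zero [Fintype F] :
    Nat.card {B : {B : Matrix (ι ⊕ κ) (ι ⊕ κ) F // Bᵀ = B} // B.1.toBlocks₁₁ = 0} =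
      Fintype.card F ^ (Fintype.card ι * Fintype.card κ) *
        Nat.card {B : Matrix κ κ F // Bᵀ = B} := by
  have e : {B : {B : Matrix (ι ⊕ κ) (ι ⊕ κ) F // Bᵀ = B} // B.1.toBlocks₁₁ = 0} ≃
      Matrix ι κ F × {B : Matrix κ κ F // Bᵀ = B} :=
    { toFun := fun B => (B.1.1.toBlocks₁₂, ⟨B.1.1.toBlocks₂₂, by
        conv_rhs => rw [← B.1.2]
        rfl⟩)
      invFun := fun p => ⟨⟨fromBlocks 0 p.1 p.1ᵀ p.2.1, by
        rw [fromBlocks_transpose, p.2.2, transpose_transpose, transpose_zero]⟩, by simp⟩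
      left_inv := fun B => by
        obtain ⟨⟨B, h⟩, h0⟩ := B
        refine Subtype.ext (Subtype.ext ?_)
        have h2 : B.toBlocks₁₂ᵀ = B.toBlocks₂₁ := by
          conv_rhs => rw [← h]
          rfl
        dsimp only at h0 ⊢
        rw [h2, ← h0, fromBlocks_toBlocks]
      right_inv := fun p => by simp }
  rw [Nat.card_congr e, Nat.card_prod]
  congr 1
  exact card_matrix ι κ F

variable [DecidableEq ι] [DecidableEq κ]

theorem card_fromBlocks_zero₁₂ [Fintype F] (S : Matrix ι ι F → Prop) (T : Matrix κ κ F → Prop) :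
    Nat.card {A : Matrix (ι ⊕ κ) (ι ⊕ κ) F // IsUnit A.det ∧ A.toBlocks₁₂ = 0 ∧
        S A.toBlocks₁₁ ∧ T A.toBlocks₂₂} =
      Fintype.card F ^ (Fintype.card ι * Fintype.card κ) *
        Nat.card {A : Matrix ι ι F // IsUnit A.det ∧ S A} *
          Nat.card {A : Matrix κ κ F // IsUnit A.det ∧ T A} := by
  have e : {A : Matrix (ι ⊕ κ) (ι ⊕ κ) F // IsUnit A.det ∧ A.toBlocks₁₂ = 0 ∧
        S A.toBlocks₁₁ ∧ T A.toBlocks₂₂} ≃ (Matrix κ ι F × {A : Matrix ι ι F // IsUnit A.det ∧ S A}) ×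
          {A : Matrix κ κ F // IsUnit A.det ∧ T A} :=
    { toFun := fun A => ((A.1.toBlocks₂₁, ⟨A.1.toBlocks₁₁, by
          have h := A.2.1
          rw [← fromBlocks_toBlocks A.1, A.2.2.1, det_fromBlocks_zero₁₂, IsUnit.mul_iff] at h
          exact h.1, A.2.2.2.1⟩), ⟨A.1.toBlocks₂₂, by
          have h := A.2.1
          rw [← fromBlocks_toBlocks A.1, A.2.2.1, det_fromBlocks_zero₁₂, IsUnit.mul_iff] at h
          exact h.2, A.2.2.2.2⟩)
      invFun := fun p => ⟨fromBlocks p.1.2.1 0 p.1.1 p.2.1, by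
        rw [det_fromBlocks_zero₁₂]
        exact p.1.2.2.1.mul p.2.2.1, by simp, by simpa using p.1.2.2.2, by simpa using p.2.2.2⟩
      left_inv := fun A => by
        apply Subtype.ext
        dsimp only
        conv_rhs => rw [← fromBlocks_toBlocks A.1, A.2.2.1]
      right_inv := fun p => by simp }
  rw [Nat.card_congr e, Nat.card_prod, Nat.card_prod]
  congr 2
  rw [card_matrix, mul_comm]

theorem toBlocks₂₂_inv_of_toBlocks₁₂_eq_zero {A : Matrix (ι ⊕ κ) (ι ⊕ κ) F} (hA : IsUnit A.det)
    (h0 : A.toBlocks₁₂ = 0) :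
    A⁻¹.toBlocks₁₂ = 0 ∧ A⁻¹.toBlocks₂₂ = A.toBlocks₂₂⁻¹ := by
  rw [← fromBlocks_toBlocks A, h0] at hA ⊢
  rw [det_fromBlocks_zero₁₂, IsUnit.mul_iff, ← isUnit_iff_isUnit_det, ← isUnit_iff_isUnit_det] at hA
  rw [inv_fromBlocks_zero₁₂_of_isUnit_iff _ _ _ ⟨fun _ => hA.2, fun _ => hA.1⟩]
  simp

end Blocks

/-! ### The number of nonsingular alternating matrices -/

section Alternating

variable {F : Type*} [Field F]

/-- In characteristic two, a matrix is alternating if it is symmetric with zero diagonal. -/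
def IsAlternating {ι : Type*} (M : Matrix ι ι F) : Prop := Mᵀ = M ∧ ∀ i, M i i = 0

/-- The number of nonsingular alternating matrices. -/
noncomputable def altCount (F ι : Type*) [Field F] [Fintype ι] [DecidableEq ι] : ℕ :=
  Nat.card {M : Matrix ι ι F // IsUnit M.det ∧ IsAlternating M}

theorem altCount_congr {ι κ : Type*} [Fintype ι] [DecidableEq ι] [Fintype κ] [DecidableEq κ]
    (e : ι ≃ κ) : altCount F ι = altCount F κ := by
  refine Nat.card_congr ((reindex e e).subtypeEquiv fun M => ?_)
  rw [det_reindex_self]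
  refine and_congr_right fun _ => ?_
  simp only [IsAlternating, transpose_reindex, (reindex e e).injective.eq_iff]
  refine and_congr_right fun _ => ?_
  simp only [reindex_apply, submatrix_apply]
  exact (e.symm.forall_congr_right (q := fun i => M i i = 0)).symm

/-- The symmetric matrix with first row `(0, v)` and lower right block `M`. -/
def borderedMatrix {μ : Type*} (v : μ → F) (M : Matrix μ μ F) : Matrix (Unit ⊕ μ) (Unit ⊕ μ) F :=
  fromBlocks 0 (replicateRow Unit v) (replicateCol Unit v) M

theorem isAlternating_borderedMatrix {μ : Type*} (v : μ → F) (M : Matrix μ μ F) :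
    IsAlternating (borderedMatrix v M) ↔ IsAlternating M := by
  simp [IsAlternating, borderedMatrix, fromBlocks_transpose, fromBlocks_inj]

theorem IsAlternating.eq_borderedMatrix {μ : Type*} {M : Matrix (Unit ⊕ μ) (Unit ⊕ μ) F}
    (hM : IsAlternating M) :
    M = borderedMatrix (fun i => M (Sum.inr i) (Sum.inl ())) M.toBlocks₂₂ := by
  ext i j
  rcases i with i | i <;> rcases j with j | j
  · exact hM.2 _
  · exact congrFun (congrFun hM.1.symm _) _
  · rfl
  · rfl

/-- Alternating matrices are determined by their first column and their lower right block. -/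
def alternatingBorderEquiv {μ : Type*} (p : Matrix (Unit ⊕ μ) (Unit ⊕ μ) F → Prop) :
    {M : Matrix (Unit ⊕ μ) (Unit ⊕ μ) F // p M ∧ IsAlternating M} ≃
      Σ v : μ → F, {M : Matrix μ μ F // p (borderedMatrix v M) ∧ IsAlternating M} where
  toFun M := ⟨fun i => M.1 (Sum.inr i) (Sum.inl ()), M.1.toBlocks₂₂, by
    rw [← M.2.2.eq_borderedMatrix]; exact M.2.1, by
    rw [← isAlternating_borderedMatrix, ← M.2.2.eq_borderedMatrix]; exact M.2.2⟩
  invFun x := ⟨borderedMatrix x.1 x.2.1, x.2.2.1, (isAlternating_borderedMatrix _ _).2 x.2.2.2⟩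
  left_inv M := Subtype.ext M.2.2.eq_borderedMatrix.symm
  right_inv x := rfl

variable {μ κ : Type*} [Fintype μ] [Fintype κ]

theorem borderedMatrix_congruence (g M : Matrix μ μ F) (v : μ → F) :
    borderedMatrix (g *ᵥ v) (g * M * gᵀ) =
      fromBlocks 1 0 0 g * borderedMatrix v M * fromBlocks 1 0 0 gᵀ := by
  simp only [borderedMatrix, fromBlocks_multiply, Matrix.one_mul, Matrix.mul_one, Matrix.zero_mul,
    Matrix.mul_zero, add_zero, zero_add, replicateCol_mulVec]
  congr 1
  rw [← transpose_replicateCol, replicateCol_mulVec, transpose_mul, transpose_replicateCol]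

/-- In the double sum for a diagonal entry, the terms at `(a, b)` and `(b, a)` agree and cancel in
characteristic two, while those with `a = b` vanish. -/
theorem IsAlternating.congruence {M : Matrix μ μ F} (hM : IsAlternating M) [CharP F 2]
    (g : Matrix μ μ F) : IsAlternating (g * M * gᵀ) := by
  refine ⟨by rw [transpose_mul, transpose_mul, transpose_transpose, hM.1, Matrix.mul_assoc],
    fun i => ?_⟩
  simp only [mul_apply, transpose_apply, Finset.sum_mul]
  rw [← Finset.sum_product']
  refine Finset.sum_involution (fun p _ => p.swap) ?_ ?_ ?_ ?_
  · rintro ⟨a, b⟩ _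
    have := congrFun (congrFun hM.1 a) b
    rw [transpose_apply] at this
    dsimp only [Prod.swap]
    rw [this, show g i b * M a b * g i a = g i a * M a b * g i b by ring]
    exact CharTwo.add_self_eq_zero _
  · rintro ⟨a, b⟩ _ h h'
    obtain rfl : b = a := congrArg Prod.fst h'
    exact h (by simp [hM.2])
  · simp
  · simp

variable [DecidableEq μ] [DecidableEq κ]

/-- The isomorphism of lines sending `v` to `w` extends to an automorphism of the whole space. -/
theorem exists_mulVec_eq {v w : μ → F} (hv : v ≠ 0) (hw : w ≠ 0) :
    ∃ g : Matrix μ μ F, IsUnit g.det ∧ g *ᵥ v = w := by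
  obtain ⟨g, hg⟩ := Submodule.exists_linearEquiv_restrict_eq
    ((LinearEquiv.toSpanNonzeroSingleton F _ v hv).symm.trans
      (LinearEquiv.toSpanNonzeroSingleton F _ w hw))
  refine ⟨LinearMap.toMatrix' (g : (μ → F) →ₗ[F] (μ → F)), ?_, ?_⟩
  · rw [LinearMap.det_toMatrix']
    exact g.isUnit_det'
  · rw [LinearMap.toMatrix'_mulVec]
    have := hg ⟨v, Submodule.mem_span_singleton_self v⟩
    rw [LinearEquiv.coe_coe, ← this, LinearEquiv.trans_apply,
      show (⟨v, Submodule.mem_span_singleton_self v⟩ : Submodule.span F {v}) =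
        LinearEquiv.toSpanNonzeroSingleton F _ v hv 1 by
        rw [LinearEquiv.toSpanNonzeroSingleton_one], LinearEquiv.symm_apply_apply,
      LinearEquiv.toSpanNonzeroSingleton_one]

theorem card_bordered_eq_of_mulVec [CharP F 2] [Finite F] {g : Matrix μ μ F} (hg : IsUnit g.det)
    (v : μ → F) :
    Nat.card {M : Matrix μ μ F // IsUnit (borderedMatrix (g *ᵥ v) M).det ∧ IsAlternating M} =
      Nat.card {M : Matrix μ μ F // IsUnit (borderedMatrix v M).det ∧ IsAlternating M} := by
  have hg' : IsUnit gᵀ.det := by rwa [det_transpose]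
  symm
  refine Nat.card_congr
    { toFun := fun M => ⟨g * M.1 * gᵀ, ?_, M.2.2.congruence g⟩
      invFun := fun M => ⟨g⁻¹ * M.1 * g⁻¹ᵀ, ?_, M.2.2.congruence _⟩
      left_inv := fun M => ?_
      right_inv := fun M => ?_ }
  · rw [borderedMatrix_congruence]
    simpa [det_fromBlocks_zero₁₂, IsUnit.mul_iff, ← isUnit_iff_ne_zero, hg] using M.2.1
  · have h := M.2.1
    rw [show M.1 = g * (g⁻¹ * M.1 * g⁻¹ᵀ) * gᵀ by
      rw [transpose_nonsing_inv, Matrix.mul_assoc, Matrix.mul_assoc, nonsing_inv_mul _ hg',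
        Matrix.mul_one, mul_nonsing_inv_cancel_left _ _ hg], borderedMatrix_congruence, det_mul,
      det_mul, IsUnit.mul_iff, IsUnit.mul_iff] at h
    exact h.1.2
  · apply Subtype.ext
    simp only
    rw [transpose_nonsing_inv, Matrix.mul_assoc, Matrix.mul_assoc, mul_nonsing_inv _ hg',
        Matrix.mul_one, nonsing_inv_mul_cancel_left _ _ hg]
  · apply Subtype.ext
    simp only
    rw [transpose_nonsing_inv, Matrix.mul_assoc, Matrix.mul_assoc, nonsing_inv_mul _ hg',
        Matrix.mul_one, mul_nonsing_inv_cancel_left _ _ hg]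

theorem det_borderedMatrix_zero (M : Matrix μ μ F) : (borderedMatrix 0 M).det = 0 :=
  det_eq_zero_of_row_eq_zero (Sum.inl ()) fun j => by rcases j <;> simp [borderedMatrix]

/-- Exchanging the first two rows leaves a block triangular matrix with diagonal blocks `1`, `1`,
`M`. The vector `w` plays no role, hence is free in the count. -/
theorem isUnit_det_borderedMatrix_borderedMatrix (w : κ → F) (M : Matrix κ κ F) :
    IsUnit (borderedMatrix (Sum.elim 1 0 : Unit ⊕ κ → F) (borderedMatrix w M)).det ↔
      IsUnit M.det := by
  have h : (borderedMatrix (Sum.elim 1 0 : Unit ⊕ κ → F) (borderedMatrix w M)).submatrix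
      (Equiv.swap (Sum.inl ()) (Sum.inr (Sum.inl ()))) id =
      fromBlocks 1 (replicateRow Unit (Sum.elim 0 w)) 0
        (fromBlocks 1 0 (replicateCol Unit w) M) := by
    ext i j
    rcases i with i | i | i <;> rcases j with j | j | j <;>
      simp [borderedMatrix, Equiv.swap_apply_of_ne_of_ne]
  have h2 := congrArg det h
  rw [det_permute, det_fromBlocks_zero₂₁, det_fromBlocks_zero₁₂, det_one, one_mul,
    one_mul] at h2
  rw [← h2, IsUnit.mul_iff]
  exact (and_iff_right (by simp)).symm

/-- The first column below the diagonal must be nonzero, and congruence by `GL` makes all nonzero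
choices equivalent. It suffices to count for the first basis vector, where the second column is free
and the remaining block is any nonsingular alternating matrix. -/
theorem altCount_add_two [CharP F 2] [Fintype F] :
    altCount F (Unit ⊕ (Unit ⊕ κ)) =
      (Fintype.card F ^ (Fintype.card κ + 1) - 1) * (Fintype.card F ^ Fintype.card κ *
        altCount F κ) := by
  classical
  have h1 : Nat.card {M : Matrix (Unit ⊕ κ) (Unit ⊕ κ) F //
      IsUnit (borderedMatrix (Sum.elim 1 0 : Unit ⊕ κ → F) M).det ∧ IsAlternating M} =
      Fintype.card F ^ Fintype.card κ * altCount F κ := by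
    rw [Nat.card_congr (alternatingBorderEquiv fun M =>
      IsUnit (borderedMatrix (Sum.elim 1 0 : Unit ⊕ κ → F) M).det), Nat.card_sigma]
    simp only [isUnit_det_borderedMatrix_borderedMatrix]
    simp [altCount]
  have he : (Sum.elim 1 0 : Unit ⊕ κ → F) ≠ 0 := fun h => by
    simpa using congrFun h (Sum.inl ())
  have h2 : ∀ v : Unit ⊕ κ → F, v ≠ 0 → Nat.card {M : Matrix (Unit ⊕ κ) (Unit ⊕ κ) F //
      IsUnit (borderedMatrix v M).det ∧ IsAlternating M} =
      Fintype.card F ^ Fintype.card κ * altCount F κ := by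
    intro v hv
    obtain ⟨g, hg, rfl⟩ := exists_mulVec_eq he hv
    rw [card_bordered_eq_of_mulVec hg, h1]
  have h3 : Nat.card {M : Matrix (Unit ⊕ κ) (Unit ⊕ κ) F //
      IsUnit (borderedMatrix 0 M).det ∧ IsAlternating M} = 0 := by
    simp [det_borderedMatrix_zero]
  rw [altCount, Nat.card_congr (alternatingBorderEquiv fun M => IsUnit M.det), Nat.card_sigma,
    ← Finset.add_sum_erase _ _ (Finset.mem_univ (0 : Unit ⊕ κ → F)), h3, zero_add,
    Finset.sum_congr rfl fun v hv => h2 v (Finset.ne_of_mem_erase hv), Finset.sum_const,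
    Finset.card_erase_of_mem (Finset.mem_univ _), smul_eq_mul, Finset.card_univ, Fintype.card_fun]
  simp [add_comm]

theorem altCount_fin_zero : altCount F (Fin 0) = 1 := by
  rw [altCount, Nat.card_eq_one_iff_exists]
  exact ⟨⟨0, by simp, by ext i; exact i.elim0, fun i => i.elim0⟩, fun M => Subtype.ext (by ext i; exact i.elim0)⟩

theorem altCount_succ [CharP F 2] [Fintype F] (k : ℕ) :
    altCount F (Fin (2 * (k + 1))) = (Fintype.card F ^ (2 * k + 1) - 1) *
      (Fintype.card F ^ (2 * k) * altCount F (Fin (2 * k))) := by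
  rw [altCount_congr (Fintype.equivOfCardEq (β := Unit ⊕ (Unit ⊕ Fin (2 * k)))
    (by simp; ring)), altCount_add_two, Fintype.card_fin]

theorem altCount_eq [CharP F 2] [Fintype F] (k : ℕ) :
    (altCount F (Fin (2 * k)) : ℚ) = (Fintype.card F : ℚ) ^ (k * (k - 1)) *
      ∏ j ∈ Finset.Icc 1 k, ((Fintype.card F : ℚ) ^ (2 * j - 1) - 1) := by
  induction k with
  | zero => simp [altCount_fin_zero]
  | succ k ih =>
    rw [altCount_succ, Finset.prod_Icc_succ_top (by omega), Nat.cast_mul, Nat.cast_mul, ih,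
      Nat.cast_sub (Nat.one_le_pow _ _ Fintype.card_pos),
      show 2 * (k + 1) - 1 = 2 * k + 1 by omega,
      show (k + 1) * (k + 1 - 1) = k * (k - 1) + 2 * k by cases k <;> simp; ring, pow_add]
    push_cast
    ring

end Alternating

/-! ### The order of the general linear group -/

section LinearGroup

variable {F : Type*} [Field F]

/-- The number of invertible matrices. -/
noncomputable def glCount (F ι : Type*) [Field F] [Fintype ι] [DecidableEq ι] : ℕ :=
  Nat.card {A : Matrix ι ι F // IsUnit A.det}

theorem glCount_congr {ι κ : Type*} [Fintype ι] [DecidableEq ι] [Fintype κ] [DecidableEq κ]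
    (e : ι ≃ κ) : glCount F ι = glCount F κ :=
  Nat.card_congr ((reindex e e).subtypeEquiv fun M => by rw [det_reindex_self])

theorem glCount_pos [Finite F] {ι : Type*} [Fintype ι] [DecidableEq ι] : 0 < glCount F ι := by
  have : Nonempty {A : Matrix ι ι F // IsUnit A.det} := ⟨1, by simp⟩
  exact Nat.card_pos

theorem glCount_eq_prod [Fintype F] (n : ℕ) :
    glCount F (Fin n) = ∏ i ∈ Finset.range n, (Fintype.card F ^ n - Fintype.card F ^ i) := by
  have e : GL (Fin n) F ≃ {A : Matrix (Fin n) (Fin n) F // IsUnit A.det} :=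
    { toFun := fun A => ⟨A.1, (isUnit_iff_isUnit_det _).1 A.isUnit⟩
      invFun := fun A => ((isUnit_iff_isUnit_det _).2 A.2).unit
      left_inv := fun A => Units.ext rfl
      right_inv := fun A => rfl }
  rw [glCount, ← Nat.card_congr e, card_GL_field, Finset.prod_range]

theorem glCount_succ [Fintype F] (n : ℕ) :
    (glCount F (Fin (n + 1)) : ℚ) = ((Fintype.card F : ℚ) ^ (n + 1) - 1) *
      (Fintype.card F : ℚ) ^ n * glCount F (Fin n) := by
  rw [glCount_eq_prod, glCount_eq_prod, Finset.prod_range_succ']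
  have h : ∀ i ∈ Finset.range n, Fintype.card F ^ (n + 1) - Fintype.card F ^ (i + 1) =
      Fintype.card F * (Fintype.card F ^ n - Fintype.card F ^ i) := fun i _ => by
    rw [pow_succ', pow_succ', Nat.mul_sub]
  rw [Finset.prod_congr rfl h, Finset.prod_mul_distrib, Finset.prod_const, Finset.card_range,
    pow_zero, Nat.cast_mul, Nat.cast_mul, Nat.cast_sub (Nat.one_le_pow _ _ Fintype.card_pos)]
  push_cast
  ring

theorem glCount_zero : glCount F (Fin 0) = 1 := by
  rw [glCount, Nat.card_eq_one_iff_exists]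
  exact ⟨⟨0, by simp⟩, fun M => Subtype.ext (by ext i; exact i.elim0)⟩

/-- The last factor is the order of `Sp(2k, q)`, the stabilizer of a nonsingular alternating form
under congruence. The identity is obtained by comparing the recursions of both counts; it is the
source of the product in `Bminus` and `Bplus`. -/
theorem glCount_even [CharP F 2] [Fintype F] (k : ℕ) :
    (glCount F (Fin (2 * k)) : ℚ) = altCount F (Fin (2 * k)) * ((Fintype.card F : ℚ) ^ (k ^ 2) *
      ∏ j ∈ Finset.Icc 1 k, ((Fintype.card F : ℚ) ^ (2 * j) - 1)) := by
  induction k with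
  | zero => simp [altCount_fin_zero, glCount_zero]
  | succ k ih =>
    rw [show 2 * (k + 1) = 2 * k + 1 + 1 by ring, glCount_succ, glCount_succ, ih,
      show 2 * k + 1 + 1 = 2 * (k + 1) by ring, altCount_succ,
      Finset.prod_Icc_succ_top (by omega), Nat.cast_mul,
      Nat.cast_sub (Nat.one_le_pow _ _ Fintype.card_pos)]
    push_cast
    ring

end LinearGroup

/-! ### Equidistribution of a linear functional on symmetric matrices -/

section LinearFibers

/-- Translation by multiples of a vector `w` with `f w = 1` identifies all fibres. -/
theorem card_mul_card_fiber {F V : Type*} [Field F] [Fintype F] [AddCommGroup V] [Module F V]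
    [Finite V] {f : V →ₗ[F] F} (hf : f ≠ 0) (c : F) :
    Fintype.card F * Nat.card {v // f v = c} = Nat.card V := by
  obtain ⟨w, hw⟩ : ∃ w, f w = 1 := LinearMap.surjective hf 1
  rw [← Nat.card_eq_fintype_card, ← Nat.card_prod]
  exact Nat.card_congr
    { toFun := fun p => p.2 + (p.1 - c) • w
      invFun := fun v => (f v, ⟨v - (f v - c) • w, by simp [hw]⟩)
      left_inv := fun p => by
        obtain ⟨a, v, hv⟩ := p
        simp [hw, hv]
      right_inv := fun v => by simp }

end LinearFibers

section SymmetricFunctional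

variable {F : Type*} [Field F] {ι κ : Type*} [Fintype ι] [Fintype κ]

theorem IsAlternating.trace_mul_eq_zero [CharP F 2] {M S : Matrix ι ι F} (hM : IsAlternating M)
    (hS : Sᵀ = S) : (M * S).trace = 0 := by
  simp only [trace, diag_apply, mul_apply]
  rw [← Finset.sum_product']
  refine Finset.sum_involution (fun p _ => p.swap) ?_ ?_ ?_ ?_
  · rintro ⟨a, b⟩ _
    have h1 := congrFun (congrFun hM.1 a) b
    have h2 := congrFun (congrFun hS a) b
    rw [transpose_apply] at h1 h2
    dsimp only [Prod.swap]
    rw [h1, h2]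
    exact CharTwo.add_self_eq_zero _
  · rintro ⟨a, b⟩ _ h h'
    obtain rfl : b = a := congrArg Prod.fst h'
    exact h (by simp [hM.2])
  · simp
  · simp

theorem toBlocks₁₁_mul (A B : Matrix (ι ⊕ κ) (ι ⊕ κ) F) :
    (A * B).toBlocks₁₁ = A.toBlocks₁₁ * B.toBlocks₁₁ + A.toBlocks₁₂ * B.toBlocks₂₁ := by
  conv_lhs => rw [← fromBlocks_toBlocks A, ← fromBlocks_toBlocks B, fromBlocks_multiply,
    toBlocks_fromBlocks₁₁]

/-- Elementary symmetric matrices detect everything: those in the off-diagonal blocks give the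
entries of `A₁₂`, the sums `E_ij + E_ji` in the first block give the symmetry of `A₁₁`, and `E_ii`
gives its diagonal. The converse is the orthogonality of alternating and symmetric matrices under
the trace form in characteristic two. -/
theorem forall_trace_toBlocks₁₁_mul_eq_zero_iff [CharP F 2] (A : Matrix (ι ⊕ κ) (ι ⊕ κ) F) :
    (∀ B : Matrix (ι ⊕ κ) (ι ⊕ κ) F, Bᵀ = B → (A * B).toBlocks₁₁.trace = 0) ↔
      A.toBlocks₁₂ = 0 ∧ IsAlternating A.toBlocks₁₁ := by
  classical
  constructor
  · intro h
    refine ⟨?_, ?_, ?_⟩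
    · ext i j
      have := h (fromBlocks 0 (single i j 1) (single j i 1) 0) (by simp [fromBlocks_transpose])
      rw [toBlocks₁₁_mul] at this
      simpa [trace_mul_single] using this
    · ext i j
      have := h (fromBlocks (single i j 1 + single j i 1) 0 0 0)
        (by simp [fromBlocks_transpose, add_comm])
      rw [toBlocks₁₁_mul] at this
      simp only [toBlocks_fromBlocks₁₁, toBlocks_fromBlocks₂₁, Matrix.mul_zero, add_zero,
        Matrix.mul_add, trace_add, trace_mul_single, CharTwo.add_eq_zero] at this
      simpa using this
    · intro i
      have := h (fromBlocks (single i i 1) 0 0 0) (by simp [fromBlocks_transpose])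
      rw [toBlocks₁₁_mul] at this
      simpa [trace_mul_single] using this
  · rintro ⟨h1, h2⟩ B hB
    rw [toBlocks₁₁_mul, h1, Matrix.zero_mul, add_zero]
    refine h2.trace_mul_eq_zero ?_
    conv_rhs => rw [← hB]
    rfl

/-- The symmetric matrices, as a subspace. -/
def symmetricSubmodule (F ι : Type*) [Field F] : Submodule F (Matrix ι ι F) where
  carrier := {B | Bᵀ = B}
  add_mem' {a b} ha hb := by
    change (a + b)ᵀ = a + b
    rw [transpose_add, show aᵀ = a from ha, show bᵀ = b from hb]
  zero_mem' := transpose_zero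
  smul_mem' c a ha := by
    change (c • a)ᵀ = c • a
    rw [transpose_smul, show aᵀ = a from ha]

/-- The functional `B ↦ tr (A B)₁₁` on symmetric matrices. -/
def blockTraceFunctional (A : Matrix (ι ⊕ κ) (ι ⊕ κ) F) : symmetricSubmodule F (ι ⊕ κ) →ₗ[F] F where
  toFun B := (A * B.1).toBlocks₁₁.trace
  map_add' B C := by
    rw [← trace_add]
    simp [Matrix.mul_add, toBlocks₁₁, trace]
  map_smul' c B := by
    simp [toBlocks₁₁, trace, Finset.mul_sum]

theorem card_trace_toBlocks₁₁_mul_eq [CharP F 2] [Fintype F] {A : Matrix (ι ⊕ κ) (ι ⊕ κ) F}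
    (hA : ¬ (A.toBlocks₁₂ = 0 ∧ IsAlternating A.toBlocks₁₁)) (a β : F) :
    Fintype.card F * Nat.card {B : {B : Matrix (ι ⊕ κ) (ι ⊕ κ) F // Bᵀ = B} //
        a + (A * B.1).toBlocks₁₁.trace = β} =
      Nat.card {B : Matrix (ι ⊕ κ) (ι ⊕ κ) F // Bᵀ = B} := by
  have hf : blockTraceFunctional A ≠ 0 := fun h =>
    hA ((forall_trace_toBlocks₁₁_mul_eq_zero_iff A).1 fun B hB => LinearMap.congr_fun h ⟨B, hB⟩)
  have := card_mul_card_fiber hf (β - a)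
  refine Eq.trans ?_ this
  congr 1
  refine Nat.card_congr (Equiv.subtypeEquivRight fun B => ?_)
  rw [eq_sub_iff_add_eq']
  rfl

end SymmetricFunctional

/-! ### Counting the pairs `(A, B)` of prescribed trace -/

section BlockCount

variable {F : Type*} [Field F] {ι κ : Type*} [Fintype ι] [Fintype κ] [DecidableEq ι]
  [DecidableEq κ]

/-- The number of symmetric matrices. -/
noncomputable def symCount (F ι : Type*) [Field F] : ℕ := Nat.card {B : Matrix ι ι F // Bᵀ = B}

/-- The number of invertible `A` with `tr A + tr A⁻¹ = β`. -/
noncomputable def glTraceCount (κ : Type*) [Fintype κ] [DecidableEq κ] (β : F) : ℕ :=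
  Nat.card {A : Matrix κ κ F // IsUnit A.det ∧ A.trace + A⁻¹.trace = β}

theorem card_degenerate [Fintype F] :
    Nat.card {A : {A : Matrix (ι ⊕ κ) (ι ⊕ κ) F // IsUnit A.det} //
        A.1.toBlocks₁₂ = 0 ∧ IsAlternating A.1.toBlocks₁₁} =
      Fintype.card F ^ (Fintype.card ι * Fintype.card κ) * altCount F ι * glCount F κ := by
  have := card_fromBlocks_zero₁₂ (ι := ι) (κ := κ) (F := F) IsAlternating fun _ => True
  simp only [and_true] at this
  rw [altCount, glCount, ← this]
  exact Nat.card_congr (Equiv.subtypeSubtypeEquivSubtypeInter _ fun A : Matrix _ _ F =>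
    A.toBlocks₁₂ = 0 ∧ IsAlternating A.toBlocks₁₁)

theorem card_degenerate_trace_eq [Fintype F] (β : F) :
    Nat.card {A : {A : Matrix (ι ⊕ κ) (ι ⊕ κ) F // IsUnit A.det} //
        (A.1.toBlocks₁₂ = 0 ∧ IsAlternating A.1.toBlocks₁₁) ∧
          A.1.toBlocks₂₂.trace + A.1⁻¹.toBlocks₂₂.trace = β} =
      Fintype.card F ^ (Fintype.card ι * Fintype.card κ) * altCount F ι * glTraceCount κ β := by
  have := card_fromBlocks_zero₁₂ (ι := ι) (κ := κ) (F := F) IsAlternating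
    fun A => A.trace + A⁻¹.trace = β
  rw [altCount, glTraceCount, ← this]
  refine Nat.card_congr ((Equiv.subtypeSubtypeEquivSubtypeInter _ fun A : Matrix _ _ F =>
    (A.toBlocks₁₂ = 0 ∧ IsAlternating A.toBlocks₁₁) ∧
      A.toBlocks₂₂.trace + A⁻¹.toBlocks₂₂.trace = β).trans (Equiv.subtypeEquivRight fun A => ?_))
  refine and_congr_right fun hA => ?_
  rw [and_assoc]
  refine and_congr_right fun h0 => and_congr_right fun _ => ?_
  rw [(toBlocks₂₂_inv_of_toBlocks₁₂_eq_zero hA h0).2]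

theorem card_parabolic_trace_eq [CharP F 2] [Fintype F] (β : F) :
    (Fintype.card F : ℤ) * Nat.card {x : {A : Matrix (ι ⊕ κ) (ι ⊕ κ) F // IsUnit A.det} ×
        {B : Matrix (ι ⊕ κ) (ι ⊕ κ) F // Bᵀ = B} // x.1.1.toBlocks₂₂.trace +
          x.1.1⁻¹.toBlocks₂₂.trace + (x.1.1 * x.2.1).toBlocks₁₁.trace = β} =
      symCount F (ι ⊕ κ) * (glCount F (ι ⊕ κ) -
        (Fintype.card F : ℤ) ^ (Fintype.card ι * Fintype.card κ) * altCount F ι * glCount F κ +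
        Fintype.card F * ((Fintype.card F : ℤ) ^ (Fintype.card ι * Fintype.card κ) *
          altCount F ι * glTraceCount κ β)) := by
  classical
  let c : {A : Matrix (ι ⊕ κ) (ι ⊕ κ) F // IsUnit A.det} → F := fun A =>
    A.1.toBlocks₂₂.trace + A.1⁻¹.toBlocks₂₂.trace
  let D : {A : Matrix (ι ⊕ κ) (ι ⊕ κ) F // IsUnit A.det} → Prop := fun A =>
    A.1.toBlocks₁₂ = 0 ∧ IsAlternating A.1.toBlocks₁₁
  have h1 : Nat.card {x : {A : Matrix (ι ⊕ κ) (ι ⊕ κ) F // IsUnit A.det} ×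
        {B : Matrix (ι ⊕ κ) (ι ⊕ κ) F // Bᵀ = B} // x.1.1.toBlocks₂₂.trace +
          x.1.1⁻¹.toBlocks₂₂.trace + (x.1.1 * x.2.1).toBlocks₁₁.trace = β} =
      ∑ A : {A : Matrix (ι ⊕ κ) (ι ⊕ κ) F // IsUnit A.det},
        Nat.card {B : {B : Matrix (ι ⊕ κ) (ι ⊕ κ) F // Bᵀ = B} //
          c A + (A.1 * B.1).toBlocks₁₁.trace = β} := by
    rw [← Nat.card_sigma]
    exact Nat.card_congr
      { toFun := fun x => ⟨x.1.1, x.1.2, x.2⟩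
        invFun := fun x => ⟨(x.1, x.2.1), x.2.2⟩
        left_inv := fun _ => rfl
        right_inv := fun _ => rfl }
  -- A nondegenerate `A` contributes a `1 / q` share of all `B`; a degenerate one contributes all of
  -- them or none, according to whether its constant term is `β`.
  have h2 : ∀ A, (Fintype.card F : ℤ) *
      Nat.card {B : {B : Matrix (ι ⊕ κ) (ι ⊕ κ) F // Bᵀ = B} //
          c A + (A.1 * B.1).toBlocks₁₁.trace = β} =
      symCount F (ι ⊕ κ) * (1 - (if D A then 1 else 0) +
        Fintype.card F * if D A ∧ c A = β then 1 else 0) := by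
    intro A
    by_cases hD : D A
    · have h3 := (forall_trace_toBlocks₁₁_mul_eq_zero_iff A.1).2 hD
      have h4 : ∀ B : {B : Matrix (ι ⊕ κ) (ι ⊕ κ) F // Bᵀ = B},
          c A + (A.1 * B.1).toBlocks₁₁.trace = β ↔ c A = β := fun B => by
        rw [h3 B.1 B.2, add_zero]
      simp only [h4, hD, true_and, if_true]
      by_cases hc : c A = β
      · simp only [hc, if_true, symCount]
        rw [Nat.card_congr (Equiv.subtypeUnivEquiv fun _ => trivial)]
        ring
      · simp [hc]
    · have := card_trace_toBlocks₁₁_mul_eq hD (c A) β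
      simp only [hD, false_and, if_false, symCount]
      rw [← this]
      push_cast
      ring
  have hsum : ∀ (p : {A : Matrix (ι ⊕ κ) (ι ⊕ κ) F // IsUnit A.det} → Prop)
      [DecidablePred p], (∑ A, if p A then (1 : ℤ) else 0) = Nat.card {A // p A} := fun p _ => by
    rw [Finset.sum_boole, Nat.card_eq_fintype_card, Fintype.card_subtype]
  rw [h1, Nat.cast_sum, Finset.mul_sum, Finset.sum_congr rfl fun A _ => h2 A, ← Finset.mul_sum,
    Finset.sum_add_distrib, Finset.sum_sub_distrib, ← Finset.mul_sum, hsum, hsum, card_degenerate,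
    card_degenerate_trace_eq, Finset.sum_const, Finset.card_univ, ← Nat.card_eq_fintype_card,
    nsmul_eq_mul, mul_one, glCount]
  push_cast
  rfl

theorem card_parabolic_stabilizer [Fintype F] :
    Nat.card {x : {A : Matrix (ι ⊕ κ) (ι ⊕ κ) F // IsUnit A.det} ×
        {B : Matrix (ι ⊕ κ) (ι ⊕ κ) F // Bᵀ = B} //
          x.1.1.toBlocks₁₂ = 0 ∧ x.2.1.toBlocks₁₁ = 0} =
      (Fintype.card F ^ (Fintype.card ι * Fintype.card κ) * glCount F ι * glCount F κ) *
        (Fintype.card F ^ (Fintype.card ι * Fintype.card κ) * symCount F κ) := by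
  have h1 := card_fromBlocks_zero₁₂ (ι := ι) (κ := κ) (F := F) (fun _ => True) fun _ => True
  simp only [and_true] at h1
  rw [Nat.card_congr (Equiv.subtypeProdEquivProd
    (p := fun A : {A : Matrix (ι ⊕ κ) (ι ⊕ κ) F // IsUnit A.det} => A.1.toBlocks₁₂ = 0)
    (q := fun B : {B : Matrix (ι ⊕ κ) (ι ⊕ κ) F // Bᵀ = B} => B.1.toBlocks₁₁ = 0)),
    Nat.card_prod, card_isSymm_toBlocks₁₁_eq_zero, symCount, glCount, glCount, ← h1]
  congr 1
  exact Nat.card_congr (Equiv.subtypeSubtypeEquivSubtypeInter _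
    fun A : Matrix (ι ⊕ κ) (ι ⊕ κ) F => A.toBlocks₁₂ = 0)

end BlockCount

/-! ### The Siegel parabolic as a subgroup of the form-preserving units -/

section Siegel

variable {F : Type*} [Field F]

/-- The form `[0, 1; 1, 0]`. -/
def formJ (F ν : Type*) [Field F] [DecidableEq ν] : Matrix (ν ⊕ ν) (ν ⊕ ν) F := fromBlocks 0 1 1 0

variable {ν : Type*} [Fintype ν] [DecidableEq ν]

theorem formJ_mul_self : formJ F ν * formJ F ν = 1 := by
  simp [formJ, fromBlocks_multiply]

theorem inv_eq_of_form {u : (Matrix (ν ⊕ ν) (ν ⊕ ν) F)ˣ}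
    (h : (u : Matrix (ν ⊕ ν) (ν ⊕ ν) F)ᵀ * formJ F ν * (u : Matrix (ν ⊕ ν) (ν ⊕ ν) F) = formJ F ν) :
    ((u⁻¹ : (Matrix (ν ⊕ ν) (ν ⊕ ν) F)ˣ) : Matrix (ν ⊕ ν) (ν ⊕ ν) F) =
      formJ F ν * (u : Matrix (ν ⊕ ν) (ν ⊕ ν) F)ᵀ * formJ F ν := by
  refine Units.inv_eq_of_mul_eq_one_left ?_
  rw [Matrix.mul_assoc, Matrix.mul_assoc, ← Matrix.mul_assoc _ (formJ F ν), h, formJ_mul_self]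

variable (F ν) in
/-- The group of invertible matrices that preserve the form. -/
def formGroup : Subgroup (Matrix (ν ⊕ ν) (ν ⊕ ν) F)ˣ where
  carrier := {u | (u : Matrix (ν ⊕ ν) (ν ⊕ ν) F)ᵀ * formJ F ν * (u : Matrix (ν ⊕ ν) (ν ⊕ ν) F) =
    formJ F ν}
  mul_mem' {u v} hu hv := by
    change (u.1 * v.1)ᵀ * formJ F ν * (u.1 * v.1) = formJ F ν
    rw [transpose_mul, Matrix.mul_assoc, Matrix.mul_assoc, ← Matrix.mul_assoc (formJ F ν),
      ← Matrix.mul_assoc u.1ᵀ, ← Matrix.mul_assoc u.1ᵀ, show _ = formJ F ν from hu,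
      ← Matrix.mul_assoc]
    exact hv
  one_mem' := by
    change (1 : Matrix _ _ F)ᵀ * formJ F ν * 1 = formJ F ν
    simp
  inv_mem' {u} hu := by
    have hu' : u.1ᵀ * formJ F ν * u.1 = formJ F ν := hu
    have h2 : u.1 * u⁻¹.1 = 1 := u.mul_inv
    have h3 : u⁻¹.1ᵀ * u.1ᵀ = 1 := by rw [← transpose_mul, h2, transpose_one]
    change u⁻¹.1ᵀ * formJ F ν * u⁻¹.1 = formJ F ν
    calc u⁻¹.1ᵀ * formJ F ν * u⁻¹.1 = u⁻¹.1ᵀ * (u.1ᵀ * formJ F ν * u.1) * u⁻¹.1 := by rw [hu']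
      _ = (u⁻¹.1ᵀ * u.1ᵀ) * formJ F ν * (u.1 * u⁻¹.1) := by simp only [Matrix.mul_assoc]
      _ = formJ F ν := by rw [h2, h3, Matrix.one_mul, Matrix.mul_one]

variable (F ν) in
/-- The Siegel parabolic subgroup: the form-preserving matrices with zero lower left block. -/
def siegel : Subgroup (Matrix (ν ⊕ ν) (ν ⊕ ν) F)ˣ where
  carrier := {u | u ∈ formGroup F ν ∧ (u : Matrix (ν ⊕ ν) (ν ⊕ ν) F).toBlocks₂₁ = 0}
  mul_mem' {u v} hu hv := by
    refine ⟨mul_mem hu.1 hv.1, ?_⟩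
    rw [Units.val_mul, ← fromBlocks_toBlocks u.1, ← fromBlocks_toBlocks v.1, fromBlocks_multiply,
      toBlocks_fromBlocks₂₁, hu.2, hv.2, Matrix.zero_mul, Matrix.mul_zero, add_zero]
  one_mem' := ⟨one_mem _, by rw [Units.val_one, ← fromBlocks_one, toBlocks_fromBlocks₂₁]⟩
  inv_mem' {u} hu := by
    refine ⟨inv_mem hu.1, ?_⟩
    rw [inv_eq_of_form hu.1, ← fromBlocks_toBlocks u.1, hu.2, formJ, fromBlocks_transpose,
      fromBlocks_multiply, fromBlocks_multiply, toBlocks_fromBlocks₂₁]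
    simp

/-- The matrix `[A, 0; 0, ᵗA⁻¹] * [1, B; 0, 1]`. -/
noncomputable def siegelMatrix (A B : Matrix ν ν F) : Matrix (ν ⊕ ν) (ν ⊕ ν) F :=
  fromBlocks A (A * B) 0 A⁻¹ᵀ

theorem isUnit_siegelMatrix {A : Matrix ν ν F} (hA : IsUnit A.det) (B : Matrix ν ν F) :
    IsUnit (siegelMatrix A B) := by
  rw [siegelMatrix, isUnit_fromBlocks_zero₂₁, isUnit_iff_isUnit_det, isUnit_iff_isUnit_det,
    det_transpose]
  exact ⟨hA, isUnit_nonsing_inv_det A hA⟩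

theorem siegelMatrix_form [CharP F 2] {A B : Matrix ν ν F} (hA : IsUnit A.det) (hB : Bᵀ = B) :
    (siegelMatrix A B)ᵀ * formJ F ν * siegelMatrix A B = formJ F ν := by
  have h1 : Aᵀ * A⁻¹ᵀ = 1 := by rw [← transpose_mul, nonsing_inv_mul _ hA, transpose_one]
  have h2 : B + B = 0 := by
    ext i j
    exact CharTwo.add_self_eq_zero _
  simp [siegelMatrix, formJ, fromBlocks_transpose, fromBlocks_multiply, hB, Matrix.mul_assoc, h1,
    nonsing_inv_mul _ hA, nonsing_inv_mul_cancel_left A _ hA, h2]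

/-- For `w` with blocks `A, X, 0, D`, preserving the form means `ᵗD A = 1` and `ᵗX D + ᵗD X = 0`.
Hence `B = ᵗD X = A⁻¹X` is symmetric in characteristic two. -/
theorem exists_eq_siegelMatrix [CharP F 2] {w : Matrix (ν ⊕ ν) (ν ⊕ ν) F}
    (hw : wᵀ * formJ F ν * w = formJ F ν) (h0 : w.toBlocks₂₁ = 0) :
    ∃ A B : Matrix ν ν F, IsUnit A.det ∧ Bᵀ = B ∧ w = siegelMatrix A B := by
  rw [← fromBlocks_toBlocks w, h0] at hw ⊢
  generalize w.toBlocks₁₁ = A at hw ⊢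
  generalize w.toBlocks₁₂ = X at hw ⊢
  generalize w.toBlocks₂₂ = D at hw ⊢
  simp only [formJ, fromBlocks_transpose, fromBlocks_multiply, fromBlocks_inj, transpose_zero,
    Matrix.mul_zero, Matrix.zero_mul, Matrix.mul_one, add_zero, zero_add] at hw
  obtain ⟨-, -, h2, h3⟩ := hw
  have h4 : A * Dᵀ = 1 := mul_eq_one_comm.1 h2
  refine ⟨A, Dᵀ * X, ?_, ?_, ?_⟩
  · exact isUnit_det_of_right_inverse h4
  · rw [transpose_mul, transpose_transpose]
    ext i j
    exact (CharTwo.add_eq_zero.1 (congrFun (congrFun h3 i) j)).symm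
  · rw [siegelMatrix, ← Matrix.mul_assoc, h4, Matrix.one_mul, inv_eq_right_inv h4,
      transpose_transpose]

theorem mem_siegel_iff [CharP F 2] (u : (Matrix (ν ⊕ ν) (ν ⊕ ν) F)ˣ) :
    u ∈ siegel F ν ↔ ∃ A B : Matrix ν ν F, IsUnit A.det ∧ Bᵀ = B ∧ u.1 = siegelMatrix A B := by
  constructor
  · rintro ⟨hu, h0⟩
    exact exists_eq_siegelMatrix hu h0
  · rintro ⟨A, B, hA, hB, h⟩
    refine ⟨?_, by rw [h, siegelMatrix, toBlocks_fromBlocks₂₁]⟩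
    change u.1ᵀ * formJ F ν * u.1 = formJ F ν
    rw [h, siegelMatrix_form hA hB]

variable (F ν) in
/-- The parametrization of the Siegel parabolic subgroup. -/
noncomputable def siegelEquiv [CharP F 2] :
    {A : Matrix ν ν F // IsUnit A.det} × {B : Matrix ν ν F // Bᵀ = B} ≃ siegel F ν :=
  Equiv.ofBijective (fun x => ⟨(isUnit_siegelMatrix x.1.2 x.2.1).unit,
      siegelMatrix_form x.1.2 x.2.2, toBlocks_fromBlocks₂₁ _ _ _ _⟩) ⟨by
    rintro ⟨⟨A, hA⟩, ⟨B, hB⟩⟩ ⟨⟨A', hA'⟩, ⟨B', hB'⟩⟩ h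
    have h1 : siegelMatrix A B = siegelMatrix A' B' := congrArg (fun z => z.1.1) h
    rw [siegelMatrix, siegelMatrix, fromBlocks_inj] at h1
    obtain ⟨rfl, h2, -⟩ := h1
    obtain rfl : B = B' := by
      rw [← nonsing_inv_mul_cancel_left A B hA, h2, nonsing_inv_mul_cancel_left A B' hA]
    rfl, by
    rintro ⟨u, hu⟩
    obtain ⟨A, B, hA, hB, h⟩ := (mem_siegel_iff u).1 hu
    exact ⟨(⟨A, hA⟩, ⟨B, hB⟩), Subtype.ext (Units.ext h.symm)⟩⟩

theorem siegelEquiv_coe [CharP F 2]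
    (x : {A : Matrix ν ν F // IsUnit A.det} × {B : Matrix ν ν F // Bᵀ = B}) :
    ((siegelEquiv F ν x : (Matrix (ν ⊕ ν) (ν ⊕ ν) F)ˣ) : Matrix (ν ⊕ ν) (ν ⊕ ν) F) =
      siegelMatrix x.1.1 x.2.1 := rfl

theorem card_siegel [CharP F 2] : Nat.card (siegel F ν) = glCount F ν * symCount F ν := by
  rw [← Nat.card_congr (siegelEquiv F ν), Nat.card_prod]
  rfl

end Siegel

/-! ### The trace and the stabilizer for the Bruhat representative -/

section Bruhat

variable {F : Type*} [Field F] {ι κ : Type*} [Fintype ι] [Fintype κ] [DecidableEq ι]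
  [DecidableEq κ]

/-- The Bruhat representative, with blocks indexed by `ι` and `κ`. -/
def bruhatMatrix (F ι κ : Type*) [Field F] [DecidableEq ι] [DecidableEq κ] :
    Matrix ((ι ⊕ κ) ⊕ (ι ⊕ κ)) ((ι ⊕ κ) ⊕ (ι ⊕ κ)) F :=
  fromBlocks (fromBlocks 0 0 0 1) (fromBlocks 1 0 0 0) (fromBlocks 1 0 0 0) (fromBlocks 0 0 0 1)

theorem bruhatMatrix_mul_self : bruhatMatrix F ι κ * bruhatMatrix F ι κ = 1 := by
  simp [bruhatMatrix, fromBlocks_multiply, fromBlocks_add]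

variable (F ι κ) in
/-- The Bruhat representative, as an invertible matrix. -/
def bruhat : (Matrix ((ι ⊕ κ) ⊕ (ι ⊕ κ)) ((ι ⊕ κ) ⊕ (ι ⊕ κ)) F)ˣ :=
  ⟨bruhatMatrix F ι κ, bruhatMatrix F ι κ, bruhatMatrix_mul_self, bruhatMatrix_mul_self⟩

theorem bruhat_mem_formGroup : bruhat F ι κ ∈ formGroup F (ι ⊕ κ) := by
  change (bruhatMatrix F ι κ)ᵀ * formJ F (ι ⊕ κ) * bruhatMatrix F ι κ = formJ F (ι ⊕ κ)
  rw [formJ]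
  simp [bruhatMatrix, fromBlocks_multiply, fromBlocks_transpose, fromBlocks_add]

theorem toBlocks₂₁_bruhat_conj (A X D : Matrix (ι ⊕ κ) (ι ⊕ κ) F) :
    (bruhatMatrix F ι κ * fromBlocks A X 0 D * bruhatMatrix F ι κ).toBlocks₂₁ =
      fromBlocks X.toBlocks₁₁ A.toBlocks₁₂ D.toBlocks₂₁ 0 := by
  conv_lhs => rw [← fromBlocks_toBlocks A, ← fromBlocks_toBlocks X, ← fromBlocks_toBlocks D]
  simp [bruhatMatrix, fromBlocks_multiply, fromBlocks_add]

theorem trace_fromBlocks_mul_bruhatMatrix (A X D : Matrix (ι ⊕ κ) (ι ⊕ κ) F) :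
    (fromBlocks A X 0 D * bruhatMatrix F ι κ).trace =
      A.toBlocks₂₂.trace + X.toBlocks₁₁.trace + D.toBlocks₂₂.trace := by
  conv_lhs => rw [← fromBlocks_toBlocks A, ← fromBlocks_toBlocks X, ← fromBlocks_toBlocks D]
  simp [bruhatMatrix, fromBlocks_multiply, fromBlocks_add, trace, Fintype.sum_sum_type, add_comm]

/-- The lower left block of the conjugate has entries `(AB)₁₁`, `A₁₂` and the transpose of
`(A⁻¹)₁₂`. Once `A₁₂ = 0`, the last vanishes too, and `(AB)₁₁ = A₁₁B₁₁` with `A₁₁` invertible. -/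
theorem bruhat_conj_mem_siegel_iff [CharP F 2]
    (x : {A : Matrix (ι ⊕ κ) (ι ⊕ κ) F // IsUnit A.det} ×
      {B : Matrix (ι ⊕ κ) (ι ⊕ κ) F // Bᵀ = B}) :
    bruhat F ι κ * (siegelEquiv F (ι ⊕ κ) x : (Matrix _ _ F)ˣ) * (bruhat F ι κ)⁻¹ ∈
        siegel F (ι ⊕ κ) ↔
      x.1.1.toBlocks₁₂ = 0 ∧ x.2.1.toBlocks₁₁ = 0 := by
  obtain ⟨⟨A, hA⟩, ⟨B, hB⟩⟩ := x
  have h1 : bruhat F ι κ * (siegelEquiv F (ι ⊕ κ) (⟨A, hA⟩, ⟨B, hB⟩) : (Matrix _ _ F)ˣ) *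
      (bruhat F ι κ)⁻¹ ∈ formGroup F (ι ⊕ κ) :=
    mul_mem (mul_mem bruhat_mem_formGroup (siegelEquiv F (ι ⊕ κ) (⟨A, hA⟩, ⟨B, hB⟩)).2.1)
      (inv_mem bruhat_mem_formGroup)
  have h2 : bruhat F ι κ * (siegelEquiv F (ι ⊕ κ) (⟨A, hA⟩, ⟨B, hB⟩) : (Matrix _ _ F)ˣ) *
      (bruhat F ι κ)⁻¹ ∈ siegel F (ι ⊕ κ) ↔
      (bruhatMatrix F ι κ * siegelMatrix A B * bruhatMatrix F ι κ).toBlocks₂₁ = 0 :=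
    ⟨fun h => h.2, fun h => ⟨h1, h⟩⟩
  rw [h2, siegelMatrix, toBlocks₂₁_bruhat_conj, ← fromBlocks_zero, fromBlocks_inj, toBlocks₁₁_mul]
  dsimp only
  constructor
  · rintro ⟨h3, h4, -⟩
    refine ⟨h4, ?_⟩
    rw [h4, Matrix.zero_mul, add_zero] at h3
    have h5 := hA
    rw [← fromBlocks_toBlocks A, h4, det_fromBlocks_zero₁₂, IsUnit.mul_iff] at h5
    rw [← nonsing_inv_mul_cancel_left A.toBlocks₁₁ B.toBlocks₁₁ h5.1, h3, Matrix.mul_zero]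
  · rintro ⟨h3, h4⟩
    refine ⟨by simp [h3, h4], h3, ?_, rfl⟩
    have := (toBlocks₂₂_inv_of_toBlocks₁₂_eq_zero hA h3).1
    exact congrArg transpose this

theorem card_bruhatCell_trace_eq [CharP F 2] [Fintype F] (β : F) :
    (Fintype.card F : ℤ) * Nat.card {w : (Matrix ((ι ⊕ κ) ⊕ (ι ⊕ κ)) ((ι ⊕ κ) ⊕ (ι ⊕ κ)) F)ˣ //
        (∃ p ∈ siegel F (ι ⊕ κ), ∃ p' ∈ siegel F (ι ⊕ κ), w = p * bruhat F ι κ * p') ∧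
          w.1.trace = β} *
      ((Fintype.card F ^ (Fintype.card ι * Fintype.card κ) * glCount F ι * glCount F κ) *
        (Fintype.card F ^ (Fintype.card ι * Fintype.card κ) * symCount F κ)) =
    glCount F (ι ⊕ κ) * symCount F (ι ⊕ κ) * (symCount F (ι ⊕ κ) * (glCount F (ι ⊕ κ) -
        (Fintype.card F : ℤ) ^ (Fintype.card ι * Fintype.card κ) * altCount F ι * glCount F κ +
        Fintype.card F * ((Fintype.card F : ℤ) ^ (Fintype.card ι * Fintype.card κ) *
          altCount F ι * glTraceCount κ β))) := by
  have h1 := card_doubleCoset_fiber (siegel F (ι ⊕ κ)) (bruhat F ι κ) (fun u => u.1.trace)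
    (fun u v => trace_mul_comm _ _) β
  have h2 : Nat.card {k : siegel F (ι ⊕ κ) //
      bruhat F ι κ * (k : (Matrix _ _ F)ˣ) * (bruhat F ι κ)⁻¹ ∈ siegel F (ι ⊕ κ)} =
      (Fintype.card F ^ (Fintype.card ι * Fintype.card κ) * glCount F ι * glCount F κ) *
        (Fintype.card F ^ (Fintype.card ι * Fintype.card κ) * symCount F κ) := by
    rw [← card_parabolic_stabilizer]
    exact (Nat.card_congr ((siegelEquiv F (ι ⊕ κ)).subtypeEquiv fun x =>
      (bruhat_conj_mem_siegel_iff x).symm)).symm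
  have h3 : Nat.card {k : siegel F (ι ⊕ κ) //
      ((k : (Matrix _ _ F)ˣ) * bruhat F ι κ).1.trace = β} = Nat.card
        {x : {A : Matrix (ι ⊕ κ) (ι ⊕ κ) F // IsUnit A.det} ×
        {B : Matrix (ι ⊕ κ) (ι ⊕ κ) F // Bᵀ = B} // x.1.1.toBlocks₂₂.trace +
          x.1.1⁻¹.toBlocks₂₂.trace + (x.1.1 * x.2.1).toBlocks₁₁.trace = β} := by
    refine (Nat.card_congr ((siegelEquiv F (ι ⊕ κ)).subtypeEquiv fun x => ?_)).symm
    rw [Units.val_mul, siegelEquiv_coe, siegelMatrix]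
    change _ ↔ (_ * bruhatMatrix F ι κ).trace = β
    rw [trace_fromBlocks_mul_bruhatMatrix, add_right_comm]
    rfl
  rw [h2, h3, card_siegel] at h1
  have h4 := congrArg (Nat.cast : ℕ → ℤ) h1
  push_cast at h4
  rw [← card_parabolic_trace_eq]
  linear_combination (Fintype.card F : ℤ) * h4

end Bruhat

/-! ### Transfer from block indices to `Fin n` -/

section Transport

variable {F : Type*} [Field F]

theorem reindex_mem_P_iff (s m : ℕ)
    (w : Matrix ((Fin s ⊕ Fin m) ⊕ (Fin s ⊕ Fin m)) ((Fin s ⊕ Fin m) ⊕ (Fin s ⊕ Fin m)) F) :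
    reindex (finSumFinEquiv.sumCongr finSumFinEquiv) (finSumFinEquiv.sumCongr finSumFinEquiv) w ∈
      P F (s + m) ↔ ∃ A B : Matrix (Fin s ⊕ Fin m) (Fin s ⊕ Fin m) F,
        IsUnit A.det ∧ Bᵀ = B ∧ w = siegelMatrix A B := by
  set e : Fin s ⊕ Fin m ≃ Fin (s + m) := finSumFinEquiv
  have key : ∀ A B C D : Matrix (Fin s ⊕ Fin m) (Fin s ⊕ Fin m) F,
      reindex (e.sumCongr e) (e.sumCongr e) (fromBlocks A B C D) =
        fromBlocks (reindex e e A) (reindex e e B) (reindex e e C) (reindex e e D) := by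
    intro A B C D
    ext i j
    rcases i with i | i <;> rcases j with j | j <;> rfl
  constructor
  · rintro ⟨A, B, hB, h⟩
    refine ⟨reindex e.symm e.symm A.1, reindex e.symm e.symm B, ?_, ?_, ?_⟩
    · rw [det_reindex_self]
      exact (isUnit_iff_isUnit_det _).1 A.isUnit
    · rw [transpose_reindex, hB]
    · apply (reindex (e.sumCongr e) (e.sumCongr e)).injective
      rw [h, siegelMatrix, key, fromBlocks_multiply]
      simp [coe_units_inv, submatrix_mul_equiv, inv_submatrix_equiv]
  · rintro ⟨A, B, hA, hB, rfl⟩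
    have hA' : IsUnit (reindex e e A).det := by rwa [det_reindex_self]
    refine ⟨((isUnit_iff_isUnit_det _).2 hA').unit, reindex e e B, by rw [transpose_reindex, hB], ?_⟩
    rw [siegelMatrix, key, fromBlocks_multiply]
    simp [coe_units_inv, submatrix_mul_equiv, inv_submatrix_equiv]

theorem reindex_bruhatMatrix (s m : ℕ) :
    reindex (finSumFinEquiv.sumCongr finSumFinEquiv) (finSumFinEquiv.sumCongr finSumFinEquiv)
      (bruhatMatrix F (Fin s) (Fin m)) = sigma F (s + m) s := by
  have h1 : (fromBlocks 0 0 0 1 : Matrix (Fin s ⊕ Fin m) (Fin s ⊕ Fin m) F) =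
      (lowerId F (s + m) s).submatrix finSumFinEquiv finSumFinEquiv := by
    ext i j
    rcases i with i | i <;> rcases j with j | j <;>
      simp [lowerId, diagonal_apply, one_apply, Fin.ext_iff]
    all_goals omega
  have h2 : (fromBlocks 1 0 0 0 : Matrix (Fin s ⊕ Fin m) (Fin s ⊕ Fin m) F) =
      (upperId F (s + m) s).submatrix finSumFinEquiv finSumFinEquiv := by
    ext i j
    rcases i with i | i <;> rcases j with j | j <;>
      simp [upperId, diagonal_apply, one_apply, Fin.ext_iff]
    all_goals omega
  rw [bruhatMatrix, h1, h2, sigma]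
  ext i j
  rcases i with i | i <;> rcases j with j | j <;> simp [submatrix_apply]

theorem reindexAlgEquiv_mem_PsigmaP_iff [CharP F 2] (s m : ℕ)
    (u : (Matrix ((Fin s ⊕ Fin m) ⊕ (Fin s ⊕ Fin m)) ((Fin s ⊕ Fin m) ⊕ (Fin s ⊕ Fin m)) F)ˣ) :
    reindexAlgEquiv F F (finSumFinEquiv.sumCongr finSumFinEquiv) u.1 ∈ PsigmaP F (s + m) s ↔
      ∃ p ∈ siegel F (Fin s ⊕ Fin m), ∃ p' ∈ siegel F (Fin s ⊕ Fin m),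
        u = p * bruhat F (Fin s) (Fin m) * p' := by
  set R := reindexAlgEquiv F F ((finSumFinEquiv (m := s) (n := m)).sumCongr finSumFinEquiv)
  have hP : ∀ w, R w ∈ P F (s + m) ↔ ∃ A B : Matrix (Fin s ⊕ Fin m) (Fin s ⊕ Fin m) F,
      IsUnit A.det ∧ Bᵀ = B ∧ w = siegelMatrix A B := reindex_mem_P_iff s m
  have hσ : R (bruhatMatrix F (Fin s) (Fin m)) = sigma F (s + m) s := reindex_bruhatMatrix s m
  have hunit : ∀ p ∈ P F (s + m), ∃ v ∈ siegel F (Fin s ⊕ Fin m), R v.1 = p := by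
    intro p hp
    obtain ⟨w, rfl⟩ := R.surjective p
    obtain ⟨A, B, hA, hB, rfl⟩ := (hP w).1 hp
    exact ⟨(isUnit_siegelMatrix hA B).unit, (mem_siegel_iff _).2 ⟨A, B, hA, hB, rfl⟩, rfl⟩
  constructor
  · rintro ⟨p, hp, p', hp', h⟩
    obtain ⟨v, hv, rfl⟩ := hunit p hp
    obtain ⟨v', hv', rfl⟩ := hunit p' hp'
    refine ⟨v, hv, v', hv', Units.ext (R.injective ?_)⟩
    rw [h, ← hσ, ← map_mul, ← map_mul]
    rfl
  · rintro ⟨v, hv, v', hv', rfl⟩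
    refine ⟨R v.1, (hP _).2 ((mem_siegel_iff v).1 hv), R v'.1, (hP _).2 ((mem_siegel_iff v').1 hv'),
      ?_⟩
    rw [← hσ, ← map_mul, ← map_mul]
    rfl

theorem isUnit_of_mem_P {n : ℕ} {w : Matrix (Fin n ⊕ Fin n) (Fin n ⊕ Fin n) F}
    (hw : w ∈ P F n) : IsUnit w := by
  obtain ⟨A, B, -, rfl⟩ := hw
  refine IsUnit.mul ?_ ?_
  · rw [isUnit_fromBlocks_zero₂₁, isUnit_transpose]
    exact ⟨A.isUnit, A⁻¹.isUnit⟩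
  · rw [isUnit_fromBlocks_zero₂₁]
    exact ⟨isUnit_one, isUnit_one⟩

theorem traceCount_PsigmaP [CharP F 2] (s m : ℕ) (β : F) :
    traceCount (PsigmaP F (s + m) s) β =
      Nat.card {w : (Matrix ((Fin s ⊕ Fin m) ⊕ (Fin s ⊕ Fin m))
          ((Fin s ⊕ Fin m) ⊕ (Fin s ⊕ Fin m)) F)ˣ //
        (∃ p ∈ siegel F (Fin s ⊕ Fin m), ∃ p' ∈ siegel F (Fin s ⊕ Fin m),
          w = p * bruhat F (Fin s) (Fin m) * p') ∧ w.1.trace = β} := by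
  set e := (finSumFinEquiv (m := s) (n := m)).sumCongr finSumFinEquiv
  have htr : ∀ w, (reindexAlgEquiv F F e w).trace = w.trace := fun w => by
    simp only [trace, diag_apply, coe_reindexAlgEquiv, reindex_apply, submatrix_apply]
    exact e.symm.sum_comp fun i => w i i
  rw [traceCount, ← Nat.card_coe_set_eq]
  symm
  refine Nat.card_eq_of_bijective (fun u => ⟨reindexAlgEquiv F F e u.1.1,
    (reindexAlgEquiv_mem_PsigmaP_iff s m u.1).2 u.2.1, (htr _).trans u.2.2⟩) ⟨?_, ?_⟩
  · intro u v h
    exact Subtype.ext (Units.ext ((reindexAlgEquiv F F e).injective (congrArg Subtype.val h)))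
  · rintro ⟨w, hw, hβ⟩
    -- Every element of the double coset is invertible, so counting among units loses nothing.
    have hunit : IsUnit w := by
      obtain ⟨p, hp, p', hp', rfl⟩ := hw
      exact ((isUnit_of_mem_P hp).mul (sigma_mem_Sp F _ _).1).mul (isUnit_of_mem_P hp')
    have h1 : IsUnit ((reindexAlgEquiv F F e).symm w) := hunit.map (reindexAlgEquiv F F e).symm
    have h2 : reindexAlgEquiv F F e h1.unit.1 = w := (reindexAlgEquiv F F e).apply_symm_apply w
    refine ⟨⟨h1.unit, (reindexAlgEquiv_mem_PsigmaP_iff s m _).1 ?_, ?_⟩, Subtype.ext h2⟩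
    · rwa [h2]
    · rw [← htr, h2, hβ]

end Transport

/-! ### Evaluation of the constants and the final count -/

section Evaluation

variable {F : Type*} [Field F]

theorem symCount_eq [Fintype F] (ι : Type*) [Fintype ι] :
    symCount F ι = Fintype.card F ^ ((Fintype.card ι + 1).choose 2) := card_isSymm

theorem traceCount_PsigmaP_mul [CharP F 2] [Fintype F] (s m : ℕ) (β : F) :
    (Fintype.card F : ℚ) * traceCount (PsigmaP F (s + m) s) β *
      (((Fintype.card F : ℚ) ^ (s * m) * glCount F (Fin s) * glCount F (Fin m)) *
        ((Fintype.card F : ℚ) ^ (s * m) * (Fintype.card F : ℚ) ^ ((m + 1).choose 2))) =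
    glCount F (Fin (s + m)) * (Fintype.card F : ℚ) ^ ((s + m + 1).choose 2) *
      ((Fintype.card F : ℚ) ^ ((s + m + 1).choose 2) * (glCount F (Fin (s + m)) -
        (Fintype.card F : ℚ) ^ (s * m) * altCount F (Fin s) * glCount F (Fin m) +
        Fintype.card F * ((Fintype.card F : ℚ) ^ (s * m) *
          altCount F (Fin s) * glTraceCount (Fin m) β))) := by
  have h := card_bruhatCell_trace_eq (ι := Fin s) (κ := Fin m) β
  rw [← traceCount_PsigmaP, glCount_congr finSumFinEquiv] at h
  simp only [symCount_eq, Fintype.card_sum, Fintype.card_fin, Nat.cast_pow] at h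
  exact_mod_cast h

theorem glTraceCount_fin_one (β : F) :
    glTraceCount (Fin 1) β = Nat.card {a : F // a ≠ 0 ∧ a + a⁻¹ = β} := by
  refine Nat.card_congr ((Matrix.uniqueEquiv (m := Fin 1) (n := Fin 1)).subtypeEquiv fun A => ?_)
  rw [det_fin_one, trace_fin_one, trace_fin_one, isUnit_iff_ne_zero, inv_def, det_fin_one,
    adjugate_fin_one, Ring.inverse_eq_inv']
  simp [Matrix.uniqueEquiv]

theorem qBinom_one (n q : ℕ) : qBinom n 1 q = ((q : ℚ) ^ n - 1) / (q - 1) := by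
  simp [qBinom]

theorem qBinom_two (n q : ℕ) :
    qBinom n 2 q = ((q : ℚ) ^ n - 1) / ((q : ℚ) ^ 2 - 1) * (((q : ℚ) ^ (n - 1) - 1) / (q - 1)) := by
  simp [qBinom, Finset.prod_range_succ, div_mul_div_comm]

theorem pow_mul_pred_mul (q : ℚ) (k : ℕ) : q ^ k ^ 2 = q ^ (k * (k - 1)) * q ^ k := by
  rw [← pow_add]
  congr 1
  cases k
  · rfl
  · simp; ring

/-- The general count with `s = 2k`, `m = 1`. The term `q - 1` is the order of `GL(1, q)`, the
contribution wrongly equidistributed for degenerate `A`, which is replaced by `q` times the true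
count. -/
theorem traceCount_DCminus [CharP F 2] [Fintype F] (k : ℕ) (β : F) :
    (traceCount (DCminus F (2 * k + 1)) β : ℚ) =
      (Fintype.card F : ℚ)⁻¹ * Aminus (2 * k + 1) (Fintype.card F) *
        (Bminus (2 * k + 1) (Fintype.card F) - (Fintype.card F - 1) +
          Fintype.card F * glTraceCount (Fin 1) β) := by
  have h := traceCount_PsigmaP_mul (2 * k) 1 β
  have hq1 : (1 : ℚ) < Fintype.card F := by exact_mod_cast Fintype.one_lt_card
  have hg := glCount_pos (F := F) (ι := Fin (2 * k))
  have hg1 : (glCount F (Fin 1) : ℚ) = Fintype.card F - 1 := by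
    have := glCount_succ (F := F) 0
    simpa [glCount_zero] using this
  have hN : traceCount (DCminus F (2 * k + 1)) β = traceCount (PsigmaP F (2 * k + 1) (2 * k)) β :=
    rfl
  rw [hN]
  rw [hg1, glCount_succ (2 * k)] at h
  rw [Aminus, Bminus, qBinom_one, show (5 * (2 * k + 1) ^ 2 - 1) / 4 = 5 * k ^ 2 + 5 * k + 1 by
      rw [show 5 * (2 * k + 1) ^ 2 = 4 * (5 * k ^ 2 + 5 * k + 1) + 1 by ring]; omega,
    show (2 * k + 1 - 1) ^ 2 / 4 = k ^ 2 by
      rw [Nat.add_sub_cancel, mul_pow]; omega,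
    show (2 * k + 1 - 1) / 2 = k by omega]
  have hch : (2 * k + 1 + 1).choose 2 = 2 * k ^ 2 + 3 * k + 1 := by
    rw [Nat.choose_two_right, show (2 * k + 1 + 1) * (2 * k + 1 + 1 - 1) =
      (2 * k ^ 2 + 3 * k + 1) * 2 by rw [Nat.add_sub_cancel]; ring, Nat.mul_div_cancel _ two_pos]
  rw [hch, show Nat.choose (1 + 1) 2 = 1 from rfl] at h
  have hge := glCount_even (F := F) k
  have ha := altCount_eq (F := F) k
  have hg' : (glCount F (Fin (2 * k)) : ℚ) ≠ 0 := by exact_mod_cast hg.ne'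
  -- All powers of `q` are expressed through `q ^ k` and `q ^ (k * (k - 1))`. Treated as independent
  -- variables together with the two products, they turn the claim into a rational identity.
  have hy := pow_mul_pred_mul (Fintype.card F : ℚ) k
  generalize (traceCount (PsigmaP F (2 * k + 1) (2 * k)) β : ℚ) = N at *
  generalize (glTraceCount (Fin 1) β : ℚ) = T at *
  generalize (glCount F (Fin (2 * k)) : ℚ) = g at *
  generalize (altCount F (Fin (2 * k)) : ℚ) = a at *
  generalize (Fintype.card F : ℚ) = q at *
  have hq0 : q ≠ 0 := by linarith
  have hqq : q - 1 ≠ 0 := by linarith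
  have e1 : q ^ (5 * k ^ 2 + 5 * k + 1) = (q ^ k ^ 2) ^ 5 * (q ^ k) ^ 5 * q := by ring
  have e2 : q ^ (2 * k ^ 2 + 3 * k + 1) = (q ^ k ^ 2) ^ 2 * (q ^ k) ^ 3 * q := by ring
  have e3 : q ^ (2 * k) = (q ^ k) ^ 2 := by ring
  have e4 : q ^ (2 * k + 1) = (q ^ k) ^ 2 * q := by ring
  rw [mul_one, e2, e3, e4] at h
  rw [e1, e4]
  rw [hy] at h hge ⊢
  have hx : q ^ k ≠ 0 := pow_ne_zero _ hq0
  generalize q ^ k = x at *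
  generalize q ^ (k * (k - 1)) = z at *
  generalize (∏ j ∈ Finset.Icc 1 k, (q ^ (2 * j - 1) - 1)) = Po at *
  generalize (∏ j ∈ Finset.Icc 1 k, (q ^ (2 * j) - 1)) = Pe at *
  have hne : q * ((x ^ 2 * g * (q - 1)) * (x ^ 2 * q ^ 1)) ≠ 0 := by positivity
  apply mul_left_cancel₀ hne
  rw [show q * ((x ^ 2 * g * (q - 1)) * (x ^ 2 * q ^ 1)) * N =
    q * N * ((x ^ 2 * g * (q - 1)) * (x ^ 2 * q ^ 1)) by ring, h]
  field_simp
  rw [hge, ha]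
  ring

/-- The same with `m = 2`. The order of `GL(2, q)` contains a factor `q`, which is cancelled against
the `q` multiplying the degenerate count and absorbed into `Aplus`. -/
theorem traceCount_DCplus [CharP F 2] [Fintype F] (k : ℕ) (β : F) :
    (traceCount (DCplus F (2 * k + 2)) β : ℚ) =
      (Fintype.card F : ℚ)⁻¹ * Aplus (2 * k + 2) (Fintype.card F) *
        (Bplus (2 * k + 2) (Fintype.card F) - ((Fintype.card F : ℚ) ^ 2 - 1) * (Fintype.card F - 1) +
          glTraceCount (Fin 2) β) := by
  have h := traceCount_PsigmaP_mul (2 * k) 2 β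
  have hq1 : (1 : ℚ) < Fintype.card F := by exact_mod_cast Fintype.one_lt_card
  have hg := glCount_pos (F := F) (ι := Fin (2 * k))
  have hg2 : (glCount F (Fin 2) : ℚ) =
      ((Fintype.card F : ℚ) ^ 2 - 1) * Fintype.card F * (Fintype.card F - 1) := by
    have h1 := glCount_succ (F := F) 0
    have h2 := glCount_succ (F := F) 1
    simp only [zero_add, glCount_zero, pow_one, pow_zero, mul_one, Nat.cast_one] at h1
    rw [h1] at h2
    simpa using h2
  have hN : traceCount (DCplus F (2 * k + 2)) β = traceCount (PsigmaP F (2 * k + 2) (2 * k)) β :=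
    rfl
  rw [hN]
  rw [hg2, glCount_succ (2 * k + 1), glCount_succ (2 * k)] at h
  rw [Aplus, Bplus, qBinom_two,
    show (5 * (2 * k + 2) ^ 2 - 2 * (2 * k + 2)) / 4 = 5 * k ^ 2 + 9 * k + 4 by
      rw [show 5 * (2 * k + 2) ^ 2 = 4 * (5 * k ^ 2 + 9 * k + 4) + 2 * (2 * k + 2) by ring]; omega,
    show (2 * k + 2 - 2) ^ 2 / 4 = k ^ 2 by
      rw [Nat.add_sub_cancel, mul_pow]; omega,
    show (2 * k + 2 - 2) / 2 = k by omega, show 2 * k + 2 - 1 = 2 * k + 1 by omega]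
  have hch : (2 * k + 2 + 1).choose 2 = 2 * k ^ 2 + 5 * k + 3 := by
    rw [Nat.choose_two_right, show (2 * k + 2 + 1) * (2 * k + 2 + 1 - 1) =
      (2 * k ^ 2 + 5 * k + 3) * 2 by rw [Nat.add_sub_cancel]; ring, Nat.mul_div_cancel _ two_pos]
  rw [hch, show Nat.choose (2 + 1) 2 = 3 from rfl, show 2 * k + 1 + 1 = 2 * k + 2 by ring] at h
  have hge := glCount_even (F := F) k
  have ha := altCount_eq (F := F) k
  have hg' : (glCount F (Fin (2 * k)) : ℚ) ≠ 0 := by exact_mod_cast hg.ne'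
  have hy := pow_mul_pred_mul (Fintype.card F : ℚ) k
  generalize (traceCount (PsigmaP F (2 * k + 2) (2 * k)) β : ℚ) = N at *
  generalize (glTraceCount (Fin 2) β : ℚ) = T at *
  generalize (glCount F (Fin (2 * k)) : ℚ) = g at *
  generalize (altCount F (Fin (2 * k)) : ℚ) = a at *
  generalize (Fintype.card F : ℚ) = q at *
  have hq0 : q ≠ 0 := by linarith
  have hqq : q - 1 ≠ 0 := by linarith
  have hqq2 : q ^ 2 - 1 ≠ 0 := by nlinarith
  have e1 : q ^ (5 * k ^ 2 + 9 * k + 4) = (q ^ k ^ 2) ^ 5 * (q ^ k) ^ 9 * q ^ 4 := by ring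
  have e2 : q ^ (2 * k ^ 2 + 5 * k + 3) = (q ^ k ^ 2) ^ 2 * (q ^ k) ^ 5 * q ^ 3 := by ring
  have e3 : q ^ (2 * k) = (q ^ k) ^ 2 := by ring
  have e4 : q ^ (2 * k + 1) = (q ^ k) ^ 2 * q := by ring
  have e5 : q ^ (2 * k + 2) = (q ^ k) ^ 2 * q ^ 2 := by ring
  have e6 : q ^ (2 * k * 2) = (q ^ k) ^ 4 := by ring
  rw [e6, e2, e3, e4, e5] at h
  rw [e1, e4, e5]
  rw [hy] at h hge ⊢
  have hx : q ^ k ≠ 0 := pow_ne_zero _ hq0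
  generalize q ^ k = x at *
  generalize q ^ (k * (k - 1)) = z at *
  generalize (∏ j ∈ Finset.Icc 1 k, (q ^ (2 * j - 1) - 1)) = Po at *
  generalize (∏ j ∈ Finset.Icc 1 k, (q ^ (2 * j) - 1)) = Pe at *
  have hne : q * ((x ^ 4 * g * ((q ^ 2 - 1) * q * (q - 1))) * (x ^ 4 * q ^ 3)) ≠ 0 := by positivity
  apply mul_left_cancel₀ hne
  rw [show q * ((x ^ 4 * g * ((q ^ 2 - 1) * q * (q - 1))) * (x ^ 4 * q ^ 3)) * N =
    q * N * ((x ^ 4 * g * ((q ^ 2 - 1) * q * (q - 1))) * (x ^ 4 * q ^ 3)) by ring, h]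
  field_simp
  rw [hge, ha]
  ring

end Evaluation

end SymplecticKloosterman

theorem proposition9 {F : Type*} [Field F] [Fintype F] (q r : ℕ) (hr : 0 < r) (hq : q = 2 ^ r)
    (hF : Fintype.card F = q) :
    (∀ n : ℕ, Odd n → ∀ β : F,
      (β = 0 →
        (SymplecticKloosterman.traceCount (SymplecticKloosterman.DCminus F n) β : ℚ) =
          (q : ℚ)⁻¹ * SymplecticKloosterman.Aminus n q * SymplecticKloosterman.Bminus n q +
          (q : ℚ)⁻¹ * SymplecticKloosterman.Aminus n q * 1) ∧
      (β ≠ 0 → SymplecticKloosterman.tr r β⁻¹ = 0 →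
        (SymplecticKloosterman.traceCount (SymplecticKloosterman.DCminus F n) β : ℚ) =
          (q : ℚ)⁻¹ * SymplecticKloosterman.Aminus n q * SymplecticKloosterman.Bminus n q +
          (q : ℚ)⁻¹ * SymplecticKloosterman.Aminus n q * ((q : ℚ) + 1)) ∧
      (β ≠ 0 → SymplecticKloosterman.tr r β⁻¹ = 1 →
        (SymplecticKloosterman.traceCount (SymplecticKloosterman.DCminus F n) β : ℚ) =
          (q : ℚ)⁻¹ * SymplecticKloosterman.Aminus n q * SymplecticKloosterman.Bminus n q +
          (q : ℚ)⁻¹ * SymplecticKloosterman.Aminus n q * (-(q : ℚ) + 1))) ∧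
    (∀ n : ℕ, 2 ≤ n → Even n → ∀ β : F,
      (β ≠ 0 →
        (SymplecticKloosterman.traceCount (SymplecticKloosterman.DCplus F n) β : ℚ) =
          (q : ℚ)⁻¹ * SymplecticKloosterman.Aplus n q * SymplecticKloosterman.Bplus n q +
          (q : ℚ)⁻¹ * SymplecticKloosterman.Aplus n q *
            ((q : ℚ) * (SymplecticKloosterman.kloosterman
              (SymplecticKloosterman.canonicalChar r) β⁻¹ : ℚ) - (q : ℚ) ^ 2 - 1)) ∧
      (β = 0 →
        (SymplecticKloosterman.traceCount (SymplecticKloosterman.DCplus F n) β : ℚ) =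
          (q : ℚ)⁻¹ * SymplecticKloosterman.Aplus n q * SymplecticKloosterman.Bplus n q +
          (q : ℚ)⁻¹ * SymplecticKloosterman.Aplus n q * ((q : ℚ) ^ 3 - (q : ℚ) ^ 2 - 1))) := by
  have hF2 : Fintype.card F = 2 ^ r := hF.trans hq
  have := SymplecticKloosterman.charP_two_of_card hF2
  subst hF
  refine ⟨?_, ?_⟩
  · rintro n ⟨k, rfl⟩ β
    rw [SymplecticKloosterman.traceCount_DCminus, SymplecticKloosterman.glTraceCount_fin_one]
    refine ⟨?_, fun hβ h => ?_, fun hβ h => ?_⟩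
    · rintro rfl
      rw [SymplecticKloosterman.card_unit_add_inv_eq_zero]
      push_cast
      ring
    all_goals
      have hM := congrArg (Int.cast : ℤ → ℚ)
        (SymplecticKloosterman.card_unit_add_inv_eq hr hF2 hβ)
      rw [Int.cast_natCast, SymplecticKloosterman.canonicalChar, h] at hM
      rw [hM]
      simp
      ring
  · rintro n hn ⟨l, rfl⟩ β
    obtain ⟨k, rfl⟩ : ∃ k, l = k + 1 := ⟨l - 1, by omega⟩
    rw [show k + 1 + (k + 1) = 2 * k + 2 by ring, SymplecticKloosterman.traceCount_DCplus]
    constructor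
    · intro hβ
      have hM : (SymplecticKloosterman.glTraceCount (Fin 2) β : ℚ) = _ :=
        congrArg (Int.cast : ℤ → ℚ)
          (SymplecticKloosterman.card_gl_two_trace_add_trace_inv_of_ne_zero hr hF2 hβ)
      rw [hM]
      push_cast
      ring
    · rintro rfl
      have hM : (SymplecticKloosterman.glTraceCount (Fin 2) (0 : F) : ℚ) = _ :=
        congrArg (Int.cast : ℤ → ℚ)
          (SymplecticKloosterman.card_gl_two_trace_add_trace_inv_zero (F := F))
      rw [hM]
      push_cast
      ring
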